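/- For $t>0$ let $\Theta_t(x)=\frac{1}{2\sqrt{\pi t}}e^{-x^2/(4t)}$, $x\in\mathbb{R}$, be the Gauss--Weierstrass heat kernel, and write $f\ast\Theta_t(x)=\int_{-\infty}^{\infty}f(x-y)\Theta_t(y)\,dy$. Let $L^p=L^p(\mathbb{R})$ be the space of real-valued functions with respect to Lebesgue measure, with norm $\|\cdot\|_p$, and use the convention $1/\infty=0$. For $1\le p\le\infty$ put $c_p=p^{1/p}/(p')^{1/p'}$, where $p'$ is the conjugate exponent, $1/p+1/p'=1$, and $\infty^{1/\infty}=1$ (so $c_1=c_\infty=1$). Put $\alpha_1=1$, $\alpha_\infty=\frac{1}{2\sqrt{\pi}}$ and $\alpha_q=\frac{1}{(2\sqrt{\pi})^{1-1/q}\,q^{1/(2q)}}$ for $1<q<\infty$. Let $1\le p\le\infty$. (a) If $f\in L^p$ then, for every $t>0$, the integral defining $f\ast\Theta_t(x)$ converges absolutely for every $x\in\mathbb{R}$, and $f\ast\Theta_t\in L^s$ for every $s$ with $p\le s\le\infty$. (b) Let $q,r\in[1,\infty]$ satisfy $1/p+1/q=1+1/r$, and let $K_{p,q}=(c_pc_q/c_r)^{1/2}\alpha_q$.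 Then $$\|f\ast\Theta_t\|_r\le K_{p,q}\,\|f\|_p\,t^{-(1-1/q)/2}\qquad\text{for all } f\in L^p \text{ and all } t>0.$$ The constant $K_{p,q}$ cannot be replaced with any smaller number: for every real $C<K_{p,q}$ there are $f\in L^p$ and $t>0$ with $\|f\ast\Theta_t\|_r>\max(C,0)\,\|f\|_p\,t^{-(1-1/q)/2}$. The rate is sharp as $t\to0^+$ and as $t\to\infty$: if $\psi:(0,\infty)\to(0,\infty)$ satisfies $\psi(t)=o(t^{-(1-1/q)/2})$ as $t\to0^+$ (respectively, as $t\to\infty$), then there is $G\in L^p$ such that $\|G\ast\Theta_t\|_r/\psi(t)$ is not bounded as $t\to0^+$ (respectively, as $t\to\infty$). (c) If $1\le s<p$ then $f\ast\Theta_t$ need not be in $L^s$ for $f\in L^p$: there is $f\in L^p$ such that $f\ast\Theta_t\notin L^s$ for every $t>0$. -/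

import Mathlib

open MeasureTheory Filter Topology Asymptotics
open scoped ENNReal

noncomputable section

/-- The Gauss–Weierstrass heat kernel `Θ_t(x) = exp(-x²/(4t)) / (2√(πt))`. -/
def heatKernel (t x : ℝ) : ℝ :=
  Real.exp (-x ^ 2 / (4 * t)) / (2 * Real.sqrt (Real.pi * t))

/-- The convolution `(f ∗ Θ_t)(x) = ∫ f(y) Θ_t(x - y) dy` with respect to Lebesgue measure. -/
def heatConv (f : ℝ → ℝ) (t : ℝ) : ℝ → ℝ :=
  convolution f (heatKernel t) (ContinuousLinearMap.mul ℝ ℝ) volume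

/-- `p ^ (1/p)`, with value `1` at `p = ∞`. -/
def selfRoot (p : ℝ≥0∞) : ℝ :=
  if p = ∞ then 1 else p.toReal ^ (1 / p.toReal)

/-- `c_p = p^{1/p} / p'^{1/p'}`, with `p'` the conjugate exponent; thus `c_1 = c_∞ = 1`. -/
def youngC (p : ℝ≥0∞) : ℝ :=
  selfRoot p / selfRoot p.conjExponent

/-- `α_q`, the `L^q` norm of `Θ_1`. -/
def heatAlpha (q : ℝ≥0∞) : ℝ :=
  if q = 1 then 1
  else if q = ∞ then 1 / (2 * Real.sqrt Real.pi)
  else 1 / ((2 * Real.sqrt Real.pi) ^ (1 - 1 / q.toReal) * q.toReal ^ (1 / (2 * q.toReal)))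

/-- `K_{p,q} = (c_p c_q / c_r)^{1/2} α_q`, where `1/p + 1/q = 1 + 1/r`. -/
def heatK (p q r : ℝ≥0∞) : ℝ :=
  Real.sqrt (youngC p * youngC q / youngC r) * heatAlpha q

/-- The rate `t^{-(1 - 1/q)/2}`, with `1/∞ = 0`. -/
def heatRate (q : ℝ≥0∞) (t : ℝ) : ℝ :=
  t ^ (-(1 - (1 / q).toReal) / 2)

end

/-! Write P = 1/p and R = 1/r. For 0 < R < P < 1 the sharp bound is Gaussian hypercontractivity in
disguise. If (X, Y) is a centred Gaussian pair with variances A, D and covariance B, then E[F(X)^a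
H(Y)^b] ≤ (E F(X))^a (E H(Y))^b for F, H ≥ 0 and a, b in (0, 1) as soon as a b B² ≤ (1-a)(1-b) A D.
Dividing F and H by suitable Gaussian densities turns the kernel Θ_t(y-x) into a constant multiple
of the density of such a pair, with a = P, b = 1-R and equality in the covariance condition. The
multiple is exactly K t^{-(P-R)/2} (`lintegral_rpow_mul_rpow_mul_heatKernel_le`). Testing this
bilinear estimate on F = f^p and H = (f ∗ Θ_t)^r gives the norm bound.

Hypercontractivity is proved in the manner of a central limit theorem. At a small scale σ, expand
both powers to second order around the means: the linear terms integrate to zero, the covariance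
condition makes the quadratic term nonpositive, and an error Cσ³ remains
(`IsStablePair.short_time`). Since √2 (X, Y) has the law of a sum of two independent copies, the
inequality with error e at scale σ yields error 2e at scale √2 σ (`IsStablePair.doubling`). From σ =
2^{-k/2}, k doublings reach scale 1 with error C 2^{-k/2}, which tends to 0. One C serves all steps
because averaging keeps a function in its class `IsPinched ε M L`. Approximation and Fatou's lemma
then remove the pinching.

The boundary exponents are classical: Hölder for r = ∞, contraction for p = r, Young with an
integrable factor for p = 1. Optimality comes from Gaussians, which the heat flow keeps Gaussian, so
that the quotient of norms is explicit. Sharpness of the rates follows from this optimality at each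
fixed time and the uniform boundedness principle. For (c), the function (1+|x|)^{-1/s} keeps its
slow decay under the flow. -/

/-! ### Taylor bounds for real powers near 1 -/

theorem one_add_rpow_neg_le {a d : ℝ} (ha : 0 < a) (ha1 : a < 1) (hd : 0 ≤ d) :
    (1 + d) ^ (a - 1) ≤ 1 - (1 - a) * d + d ^ 2 := by
  have h1 : (0 : ℝ) < 1 + d := by linarith
  rw [Real.rpow_sub_one h1.ne', div_le_iff₀ h1]
  have := rpow_one_add_le_one_add_mul_self (s := d) (by linarith) ha.le ha1.le
  have h3 : 0 ≤ a * d ^ 2 := by positivity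
  have h4 : 0 ≤ d ^ 3 := by positivity
  nlinarith

/-- Bernoulli's inequality for the exponent 1 - a, inverted by means of (1 - s)(1 + s) ≤ 1. It
controls the derivative of the power for negative increments. -/
theorem one_sub_le_one_add_rpow_neg {a d : ℝ} (ha : 0 < a) (ha1 : a < 1) (hd : -1 < d) :
    1 - (1 - a) * d ≤ (1 + d) ^ (a - 1) := by
  have h1 : (0 : ℝ) < 1 + d := by linarith
  have h2 := rpow_one_add_le_one_add_mul_self (s := d) (p := 1 - a) (by linarith)
    (by linarith) (by linarith)
  have h3 : 0 < (1 + d) ^ (1 - a) := Real.rpow_pos_of_pos h1 _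
  have h4 : (1 + d) ^ (a - 1) = ((1 + d) ^ (1 - a))⁻¹ := by
    rw [← Real.rpow_neg h1.le]; congr 1; ring
  rw [h4, ← one_div, le_div_iff₀ h3]
  by_cases h5 : 0 ≤ 1 - (1 - a) * d
  · nlinarith [sq_nonneg ((1 - a) * d)]
  · nlinarith

/-- Second-order Taylor upper bound for `(1 + d) ^ a` with a cubic remainder. -/
theorem one_add_rpow_le_taylor {a d : ℝ} (ha : 0 < a) (ha1 : a < 1) (hd : -1 ≤ d) :
    (1 + d) ^ a ≤ 1 + a * d - a * (1 - a) / 2 * d ^ 2 + |d| ^ 3 := by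
  have hder : ∀ x : ℝ, -1 < x → HasDerivAt (fun x : ℝ => (1 + x) ^ a) (a * (1 + x) ^ (a - 1)) x := by
    intro x hx
    have := ((hasDerivAt_id x).const_add 1).rpow_const (p := a) (Or.inl (by simp; linarith))
    simpa using this
  have hpoly : ∀ k x : ℝ, HasDerivAt (fun x : ℝ => 1 + a * x - a * (1 - a) / 2 * x ^ 2 + k * x ^ 3)
      (a - a * (1 - a) * x + k * (3 * x ^ 2)) x := by
    intro k x
    have := ((((hasDerivAt_id x).const_mul a).const_add 1).sub
      (((hasDerivAt_id x).pow 2).const_mul (a * (1 - a) / 2))).add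
      (((hasDerivAt_id x).pow 3).const_mul k)
    refine this.congr_deriv ?_
    simp; ring
  have hcont : ContinuousOn (fun x : ℝ => (1 + x) ^ a) (Set.Ici (-1)) :=
    ContinuousOn.rpow_const (by fun_prop) (fun x _ => Or.inr ha.le)
  rcases le_total 0 d with h0 | h0
  -- The gap between the polynomial and the power vanishes at 0, increases to the right and
  -- decreases to the left. The cubic coefficient is 1 on the right and -1 on the left, so that it
  -- gives |d|³ on both sides.
  · have hmono : MonotoneOn (fun x : ℝ => (1 + a * x - a * (1 - a) / 2 * x ^ 2 + 1 * x ^ 3)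
        - (1 + x) ^ a) (Set.Ici 0) := by
      apply monotoneOn_of_deriv_nonneg (convex_Ici 0)
      · exact (by fun_prop : ContinuousOn _ _).sub
          (hcont.mono (Set.Ici_subset_Ici.2 (by norm_num)))
      · intro x hx
        rw [interior_Ici, Set.mem_Ioi] at hx
        exact ((hpoly 1 x).sub (hder x (by linarith))).differentiableAt.differentiableWithinAt
      · intro x hx
        rw [interior_Ici, Set.mem_Ioi] at hx
        refine le_of_le_of_eq ?_ ((hpoly 1 x).sub (hder x (by linarith))).deriv.symm
        have := one_add_rpow_neg_le ha ha1 hx.le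
        nlinarith [mul_le_mul_of_nonneg_left this ha.le, sq_nonneg x]
    have := hmono (Set.mem_Ici.2 le_rfl) (Set.mem_Ici.2 h0) h0
    simp only [add_zero, Real.one_rpow] at this
    rw [abs_of_nonneg h0]
    linarith
  · have hmono : AntitoneOn (fun x : ℝ => (1 + a * x - a * (1 - a) / 2 * x ^ 2 + (-1) * x ^ 3)
        - (1 + x) ^ a) (Set.Icc (-1) 0) := by
      apply antitoneOn_of_deriv_nonpos (convex_Icc _ _)
      · exact (by fun_prop : ContinuousOn _ _).sub (hcont.mono Set.Icc_subset_Ici_self)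
      · intro x hx
        rw [interior_Icc, Set.mem_Ioo] at hx
        exact ((hpoly _ x).sub (hder x hx.1)).differentiableAt.differentiableWithinAt
      · intro x hx
        rw [interior_Icc, Set.mem_Ioo] at hx
        refine le_of_eq_of_le ((hpoly (-1) x).sub (hder x hx.1)).deriv ?_
        have := one_sub_le_one_add_rpow_neg ha ha1 hx.1
        nlinarith [mul_le_mul_of_nonneg_left this ha.le, sq_nonneg x]
    have := hmono (Set.mem_Icc.2 ⟨hd, h0⟩) (Set.mem_Icc.2 ⟨by norm_num, le_rfl⟩) h0
    simp only [add_zero, Real.one_rpow] at this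
    rw [abs_of_nonpos h0]
    nlinarith

/-- Two-variable version: the product `(1 + d) ^ a * (1 + e) ^ b` is bounded by its second-order
Taylor polynomial up to a cubic error, for bounded `d` and `e`. -/
theorem one_add_rpow_mul_le_taylor {a b d e N S : ℝ} (ha : 0 < a) (ha1 : a < 1) (hb : 0 < b)
    (hb1 : b < 1) (hd : -1 ≤ d) (he : -1 ≤ e) (hdN : |d| ≤ N) (heN : |e| ≤ N)
    (hdS : |d| ≤ S) (heS : |e| ≤ S) :
    (1 + d) ^ a * (1 + e) ^ b ≤ 1 + a * d + b * e
      + (a * b * (d * e) - a * (1 - a) / 2 * d ^ 2 - b * (1 - b) / 2 * e ^ 2)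
      + (5 + 4 * N + N ^ 3) * S ^ 3 := by
  have h1 := one_add_rpow_le_taylor ha ha1 hd
  have h2 := one_add_rpow_le_taylor hb hb1 he
  have hN : 0 ≤ N := (abs_nonneg d).trans hdN
  have hS : 0 ≤ S := (abs_nonneg d).trans hdS
  have h3 := mul_le_mul h1 h2 (Real.rpow_nonneg (by linarith) _)
    ((Real.rpow_nonneg (by linarith) _).trans h1)
  refine h3.trans ?_
  set A := a * (1 - a) / 2 with hA
  set B := b * (1 - b) / 2 with hB
  have hA0 : 0 ≤ A := by rw [hA]; nlinarith
  have hA1 : A ≤ 1 := by rw [hA]; nlinarith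
  have hB0 : 0 ≤ B := by rw [hB]; nlinarith
  have hB1 : B ≤ 1 := by rw [hB]; nlinarith
  have hd0 := abs_nonneg d
  have he0 := abs_nonneg e
  have k3 : |d| ^ 3 ≤ S ^ 3 := by gcongr
  have k3' : |e| ^ 3 ≤ S ^ 3 := by gcongr
  -- Every product term of degree at least three is compared with S³, surplus factors being absorbed
  -- into N; terms of favourable sign are dropped.
  have m1 : -(a * d * (B * e ^ 2)) ≤ S ^ 3 := by
    calc -(a * d * (B * e ^ 2)) ≤ |a * d * (B * e ^ 2)| := neg_le_abs _
      _ = a * B * (|d| * |e| ^ 2) := by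
        rw [abs_mul, abs_mul, abs_mul, abs_of_pos ha, abs_of_nonneg hB0, abs_pow]; ring
      _ ≤ 1 * 1 * (S * S ^ 2) := by gcongr
      _ = S ^ 3 := by ring
  have m2 : -(A * d ^ 2 * (b * e)) ≤ S ^ 3 := by
    calc -(A * d ^ 2 * (b * e)) ≤ |A * d ^ 2 * (b * e)| := neg_le_abs _
      _ = A * b * (|d| ^ 2 * |e|) := by
        rw [abs_mul, abs_mul, abs_mul, abs_of_pos hb, abs_of_nonneg hA0, abs_pow]; ring
      _ ≤ 1 * 1 * (S ^ 2 * S) := by gcongr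
      _ = S ^ 3 := by ring
  have m3 : A * d ^ 2 * (B * e ^ 2) ≤ N * S ^ 3 := by
    calc A * d ^ 2 * (B * e ^ 2) = A * B * (|d| * |d| * |e| ^ 2) := by
          rw [abs_mul_abs_self, sq_abs]; ring
      _ ≤ 1 * 1 * (N * S * S ^ 2) := by gcongr
      _ = N * S ^ 3 := by ring
  have m4 : a * d * |e| ^ 3 ≤ N * S ^ 3 := by
    calc a * d * |e| ^ 3 ≤ 1 * N * S ^ 3 := by
          have : d ≤ N := (le_abs_self d).trans hdN
          have : a * d ≤ 1 * N := by
            calc a * d ≤ a * N := by gcongr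
              _ ≤ 1 * N := by gcongr
          gcongr
      _ = N * S ^ 3 := by ring
  have m5 : b * e * |d| ^ 3 ≤ N * S ^ 3 := by
    calc b * e * |d| ^ 3 ≤ 1 * N * S ^ 3 := by
          have : e ≤ N := (le_abs_self e).trans heN
          have : b * e ≤ 1 * N := by
            calc b * e ≤ b * N := by gcongr
              _ ≤ 1 * N := by gcongr
          gcongr
      _ = N * S ^ 3 := by ring
  have m6 : |d| ^ 3 * |e| ^ 3 ≤ N ^ 3 * S ^ 3 := by gcongr
  have m7 : 0 ≤ A * d ^ 2 * |e| ^ 3 := by positivity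
  have m8 : 0 ≤ B * e ^ 2 * |d| ^ 3 := by positivity
  have hS3 : 0 ≤ S ^ 3 := by positivity
  have hNS : 0 ≤ N * S ^ 3 := by positivity
  nlinarith

/-! ### Pinched functions and stable pairs -/

/-- `f` is a function with derivative `f'`, pinched between `ε` and `M`, with `f'` bounded and
Lipschitz-type second-order control. -/
structure IsPinched (ε M L : ℝ) (f f' : ℝ → ℝ) : Prop where
  cont : Continuous f
  cont' : Continuous f'
  lower : ∀ x, ε ≤ f x
  upper : ∀ x, f x ≤ M
  bound' : ∀ x, |f' x| ≤ L
  taylor : ∀ x y, |f (x + y) - f x - f' x * y| ≤ L * y ^ 2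

/-- A centred probability measure on the plane with covariance `(A, B; B, D)`, finite sixth moments,
and stable under addition of independent copies, like a centred Gaussian. -/
structure IsStablePair (ν : Measure (ℝ × ℝ)) (A B D : ℝ) : Prop where
  moment : Integrable (fun z : ℝ × ℝ => (1 + |z.1| + |z.2|) ^ 6) ν
  mean_fst : ∫ z, z.1 ∂ν = 0
  mean_snd : ∫ z, z.2 ∂ν = 0
  var_fst : ∫ z, z.1 ^ 2 ∂ν = A
  cov : ∫ z, z.1 * z.2 ∂ν = B
  var_snd : ∫ z, z.2 ^ 2 ∂ν = D
  stable : ∀ Ψ : ℝ × ℝ → ℝ, Continuous Ψ → (∃ M, ∀ z, |Ψ z| ≤ M) →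
    ∫ z, Ψ (√2 * z.1, √2 * z.2) ∂ν = ∫ z, ∫ z', Ψ (z.1 + z'.1, z.2 + z'.2) ∂ν ∂ν

theorem IsStablePair.integrable_of_le {ν : Measure (ℝ × ℝ)} {A B D : ℝ} (h : IsStablePair ν A B D)
    {φ : ℝ × ℝ → ℝ} (hc : Continuous φ) (hφ : ∀ z, |φ z| ≤ (1 + |z.1| + |z.2|) ^ 6) :
    Integrable φ ν :=
  h.moment.mono' hc.aestronglyMeasurable (Eventually.of_forall hφ)

theorem IsStablePair.integrable_fst {ν : Measure (ℝ × ℝ)} {A B D : ℝ} (h : IsStablePair ν A B D) :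
    Integrable (fun z : ℝ × ℝ => z.1) ν :=
  h.integrable_of_le continuous_fst fun z => by
    have h1 : 1 ≤ 1 + |z.1| + |z.2| := by linarith [abs_nonneg z.1, abs_nonneg z.2]
    calc |z.1| ≤ (1 + |z.1| + |z.2|) ^ 1 := by linarith [abs_nonneg z.1, abs_nonneg z.2]
      _ ≤ _ := pow_le_pow_right₀ h1 (by norm_num)

theorem IsStablePair.integrable_snd {ν : Measure (ℝ × ℝ)} {A B D : ℝ} (h : IsStablePair ν A B D) :
    Integrable (fun z : ℝ × ℝ => z.2) ν :=
  h.integrable_of_le continuous_snd fun z => by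
    have h1 : 1 ≤ 1 + |z.1| + |z.2| := by linarith [abs_nonneg z.1, abs_nonneg z.2]
    calc |z.2| ≤ (1 + |z.1| + |z.2|) ^ 1 := by linarith [abs_nonneg z.1, abs_nonneg z.2]
      _ ≤ _ := pow_le_pow_right₀ h1 (by norm_num)

theorem IsStablePair.integrable_mul {ν : Measure (ℝ × ℝ)} {A B D : ℝ} (h : IsStablePair ν A B D) :
    Integrable (fun z : ℝ × ℝ => z.1 * z.2) ν :=
  h.integrable_of_le (by fun_prop) fun z => by
    have h1 : 1 ≤ 1 + |z.1| + |z.2| := by linarith [abs_nonneg z.1, abs_nonneg z.2]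
    calc |z.1 * z.2| ≤ (1 + |z.1| + |z.2|) ^ 2 := by
          rw [abs_mul]; nlinarith [abs_nonneg z.1, abs_nonneg z.2]
      _ ≤ _ := pow_le_pow_right₀ h1 (by norm_num)

theorem IsStablePair.integrable_fst_sq {ν : Measure (ℝ × ℝ)} {A B D : ℝ}
    (h : IsStablePair ν A B D) : Integrable (fun z : ℝ × ℝ => z.1 ^ 2) ν :=
  h.integrable_of_le (by fun_prop) fun z => by
    have h1 : 1 ≤ 1 + |z.1| + |z.2| := by linarith [abs_nonneg z.1, abs_nonneg z.2]
    calc |z.1 ^ 2| ≤ (1 + |z.1| + |z.2|) ^ 2 := by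
          rw [abs_pow]; nlinarith [abs_nonneg z.1, abs_nonneg z.2]
      _ ≤ _ := pow_le_pow_right₀ h1 (by norm_num)

theorem IsStablePair.integrable_snd_sq {ν : Measure (ℝ × ℝ)} {A B D : ℝ}
    (h : IsStablePair ν A B D) : Integrable (fun z : ℝ × ℝ => z.2 ^ 2) ν :=
  h.integrable_of_le (by fun_prop) fun z => by
    have h1 : 1 ≤ 1 + |z.1| + |z.2| := by linarith [abs_nonneg z.1, abs_nonneg z.2]
    calc |z.2 ^ 2| ≤ (1 + |z.1| + |z.2|) ^ 2 := by
          rw [abs_pow]; nlinarith [abs_nonneg z.1, abs_nonneg z.2]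
      _ ≤ _ := pow_le_pow_right₀ h1 (by norm_num)

theorem integrable_of_continuous_bounded {X : Type*} [TopologicalSpace X] [MeasurableSpace X]
    [OpensMeasurableSpace X] {ν : Measure X} [IsFiniteMeasure ν]
    [SecondCountableTopology X] {φ : X → ℝ} (hc : Continuous φ) {M : ℝ}
    (hφ : ∀ z, |φ z| ≤ M) : Integrable φ ν :=
  (integrable_const M).mono' hc.aestronglyMeasurable (Eventually.of_forall hφ)

theorem IsPinched.abs_apply_le {ε M L : ℝ} {f f' : ℝ → ℝ} (hf : IsPinched ε M L f f') (hε : 0 < ε)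
    (x : ℝ) : |f x| ≤ M := by
  rw [abs_of_nonneg (hε.le.trans (hf.lower x))]; exact hf.upper x

/-- Averages of pinched functions are pinched, with the same constants. -/
theorem IsPinched.average {X : Type*} [TopologicalSpace X] [MeasurableSpace X]
    [OpensMeasurableSpace X] [SecondCountableTopology X] {ν : Measure X} [IsProbabilityMeasure ν]
    {ε M L : ℝ} {f f' : ℝ → ℝ} (hf : IsPinched ε M L f f') (hε : 0 < ε) {T : X → ℝ}
    (hT : Continuous T) :
    IsPinched ε M L (fun x => ∫ z, f (x + T z) ∂ν) (fun x => ∫ z, f' (x + T z) ∂ν) := by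
  have hc := hf.cont
  have hc' := hf.cont'
  have hi : ∀ x, Integrable (fun z => f (x + T z)) ν := fun x =>
    integrable_of_continuous_bounded (by fun_prop) fun z => hf.abs_apply_le hε _
  have hi' : ∀ x, Integrable (fun z => f' (x + T z)) ν := fun x =>
    integrable_of_continuous_bounded (by fun_prop) fun z => hf.bound' _
  refine ⟨?_, ?_, fun x => ?_, fun x => ?_, fun x => ?_, fun x y => ?_⟩
  · refine continuous_of_dominated (bound := fun _ => M)
      (fun x => (hi x).aestronglyMeasurable) (fun x => Eventually.of_forall fun z => hf.abs_apply_le hε _)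
      (integrable_const _) (Eventually.of_forall fun z => by fun_prop)
  · refine continuous_of_dominated (bound := fun _ => L)
      (fun x => (hi' x).aestronglyMeasurable) (fun x => Eventually.of_forall fun z => hf.bound' _)
      (integrable_const _) (Eventually.of_forall fun z => by fun_prop)
  · calc ε = ∫ _, ε ∂ν := by simp
      _ ≤ _ := integral_mono (integrable_const _) (hi x) fun z => hf.lower _
  · calc _ ≤ ∫ _, M ∂ν := integral_mono (hi x) (integrable_const _) fun z => hf.upper _
      _ = M := by simp
  · have := norm_integral_le_of_norm_le_const (μ := ν) (f := fun z => f' (x + T z)) (C := L)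
      (Eventually.of_forall fun z => hf.bound' _)
    simpa using this
  · have h1 : (∫ z, f (x + y + T z) ∂ν) - (∫ z, f (x + T z) ∂ν) - (∫ z, f' (x + T z) ∂ν) * y
        = ∫ z, (f (x + T z + y) - f (x + T z) - f' (x + T z) * y) ∂ν := by
      have h2 : Integrable (fun z => f (x + T z + y)) ν := by
        have := hi (x + y)
        refine this.congr (Eventually.of_forall fun z => ?_)
        simp only; congr 1; ring
      have h3 : Integrable (fun z => f (x + T z + y) - f (x + T z)) ν := h2.sub (hi x)
      rw [integral_sub h3 ((hi' x).mul_const y), integral_sub h2 (hi x), integral_mul_const]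
      congr 3
      funext z; congr 1; ring
    rw [h1]
    have := norm_integral_le_of_norm_le_const (μ := ν)
      (f := fun z => f (x + T z + y) - f (x + T z) - f' (x + T z) * y) (C := L * y ^ 2)
      (Eventually.of_forall fun z => hf.taylor _ _)
    simpa using this

/-! ### The short-time inequality -/

/-- Replaces the relative deviations d, e in the Taylor bound by their linear parts σu, σv. Here W
stands for 1 + |z.1| + |z.2|: deviations are of size σW², so cubic errors cost σ³W⁶, whence the
sixth moment in `IsStablePair`. -/
theorem one_add_rpow_mul_le_of_near {a b d e u v κ N σ W : ℝ} (ha : 0 < a) (ha1 : a < 1) (hb : 0 < b)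
    (hb1 : b < 1) (hd : -1 ≤ d) (he : -1 ≤ e) (hdN : |d| ≤ N) (heN : |e| ≤ N)
    (hκ : 0 ≤ κ) (hσ : 0 ≤ σ) (hσ1 : σ ≤ 1) (hW : 1 ≤ W)
    (hdu : |d - σ * u| ≤ κ * σ ^ 2 * W ^ 2) (hev : |e - σ * v| ≤ κ * σ ^ 2 * W ^ 2)
    (hu : |u| ≤ κ * W) (hv : |v| ≤ κ * W) :
    (1 + d) ^ a * (1 + e) ^ b ≤ 1 + a * d + b * e
      + σ ^ 2 * (a * b * (u * v) - a * (1 - a) / 2 * u ^ 2 - b * (1 - b) / 2 * v ^ 2)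
      + ((5 + 4 * N + N ^ 3) * (2 * κ) ^ 3 + 9 * κ ^ 2) * σ ^ 3 * W ^ 6 := by
  have hσ2 : σ ^ 2 ≤ σ := by nlinarith
  have hW2 : W ≤ W ^ 2 := by nlinarith
  have hW4 : W ^ 4 ≤ W ^ 6 := pow_le_pow_right₀ hW (by norm_num)
  have su : |σ * u| ≤ κ * σ * W ^ 2 := by
    rw [abs_mul, abs_of_nonneg hσ]
    calc σ * |u| ≤ σ * (κ * W ^ 2) := by
          refine mul_le_mul_of_nonneg_left (hu.trans ?_) hσ; gcongr
      _ = _ := by ring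
  have sv : |σ * v| ≤ κ * σ * W ^ 2 := by
    rw [abs_mul, abs_of_nonneg hσ]
    calc σ * |v| ≤ σ * (κ * W ^ 2) := by
          refine mul_le_mul_of_nonneg_left (hv.trans ?_) hσ; gcongr
      _ = _ := by ring
  have sq : κ * σ ^ 2 * W ^ 2 ≤ κ * σ * W ^ 2 := by gcongr
  have hdS : |d| ≤ 2 * κ * σ * W ^ 2 := by
    have : |d| ≤ |d - σ * u| + |σ * u| := by simpa using abs_add_le (d - σ * u) (σ * u)
    linarith
  have heS : |e| ≤ 2 * κ * σ * W ^ 2 := by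
    have : |e| ≤ |e - σ * v| + |σ * v| := by simpa using abs_add_le (e - σ * v) (σ * v)
    linarith
  have key := one_add_rpow_mul_le_taylor ha ha1 hb hb1 hd he hdN heN hdS heS
  set q := κ ^ 2 * σ ^ 3 * W ^ 6 with hq
  have hq0 : 0 ≤ q := by positivity
  have hqq : κ ^ 2 * σ ^ 3 * W ^ 4 ≤ q := by rw [hq]; gcongr
  have bd : ∀ s t : ℝ, |s| ≤ κ * σ ^ 2 * W ^ 2 → |t| ≤ 3 * κ * σ * W ^ 2 → |s * t| ≤ 3 * q := by
    intro s t hs ht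
    rw [abs_mul]
    calc |s| * |t| ≤ (κ * σ ^ 2 * W ^ 2) * (3 * κ * σ * W ^ 2) := by gcongr
      _ = 3 * (κ ^ 2 * σ ^ 3 * W ^ 4) := by ring
      _ ≤ _ := by linarith
  have c1 : |d * e - σ ^ 2 * (u * v)| ≤ 3 * q := by
    have e1 : d * e - σ ^ 2 * (u * v) = (e - σ * v) * d + (d - σ * u) * (σ * v) := by ring
    rw [e1]
    refine (abs_add_le _ _).trans ?_
    rw [abs_mul, abs_mul]
    calc |e - σ * v| * |d| + |d - σ * u| * |σ * v|
        ≤ (κ * σ ^ 2 * W ^ 2) * (2 * κ * σ * W ^ 2) + (κ * σ ^ 2 * W ^ 2) * (κ * σ * W ^ 2) := by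
          gcongr
      _ = 3 * (κ ^ 2 * σ ^ 3 * W ^ 4) := by ring
      _ ≤ _ := by linarith
  have c2 : |d ^ 2 - σ ^ 2 * u ^ 2| ≤ 3 * q := by
    have e1 : d ^ 2 - σ ^ 2 * u ^ 2 = (d - σ * u) * (d + σ * u) := by ring
    rw [e1]
    exact bd _ _ hdu ((abs_add_le _ _).trans (by linarith))
  have c3 : |e ^ 2 - σ ^ 2 * v ^ 2| ≤ 3 * q := by
    have e1 : e ^ 2 - σ ^ 2 * v ^ 2 = (e - σ * v) * (e + σ * v) := by ring
    rw [e1]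
    exact bd _ _ hev ((abs_add_le _ _).trans (by linarith))
  have scale : ∀ c s : ℝ, 0 ≤ c → c ≤ 1 → s ≤ 3 * q → c * s ≤ 3 * q := fun c s hc hc1 hs =>
    (mul_le_mul_of_nonneg_left hs hc).trans (mul_le_of_le_one_left (by linarith) hc1)
  have p1 : a * b * (d * e - σ ^ 2 * (u * v)) ≤ 3 * q :=
    scale _ _ (by positivity) (mul_le_one₀ ha1.le hb.le hb1.le) ((le_abs_self _).trans c1)
  have half : ∀ c : ℝ, 0 < c → c < 1 → 0 ≤ c * (1 - c) / 2 ∧ c * (1 - c) / 2 ≤ 1 :=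
    fun c h0 h1 => ⟨by nlinarith, by nlinarith⟩
  have p2 : a * (1 - a) / 2 * (-(d ^ 2 - σ ^ 2 * u ^ 2)) ≤ 3 * q :=
    scale _ _ (half a ha ha1).1 (half a ha ha1).2 ((neg_le_abs _).trans c2)
  have p3 : b * (1 - b) / 2 * (-(e ^ 2 - σ ^ 2 * v ^ 2)) ≤ 3 * q :=
    scale _ _ (half b hb hb1).1 (half b hb hb1).2 ((neg_le_abs _).trans c3)
  have eS : (5 + 4 * N + N ^ 3) * (2 * κ * σ * W ^ 2) ^ 3
      = (5 + 4 * N + N ^ 3) * (2 * κ) ^ 3 * σ ^ 3 * W ^ 6 := by ring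
  rw [eS] at key
  have e9 : ((5 + 4 * N + N ^ 3) * (2 * κ) ^ 3 + 9 * κ ^ 2) * σ ^ 3 * W ^ 6
      = (5 + 4 * N + N ^ 3) * (2 * κ) ^ 3 * σ ^ 3 * W ^ 6 + 9 * q := by rw [hq]; ring
  rw [e9]
  linarith

/-- First-order expansion of a pinched function around its own average. -/
theorem IsPinched.deviation {X : Type*} [TopologicalSpace X] [MeasurableSpace X]
    [OpensMeasurableSpace X] [SecondCountableTopology X] {ν : Measure X} [IsProbabilityMeasure ν]
    {ε M L A : ℝ} {f f' : ℝ → ℝ} (hf : IsPinched ε M L f f') (hε : 0 < ε) {T : X → ℝ}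
    (hT : Continuous T) (hT1 : Integrable T ν) (hT2 : Integrable (fun z => T z ^ 2) ν)
    (h0 : ∫ z, T z ∂ν = 0) (hA : ∫ z, T z ^ 2 ∂ν = A) (σ x : ℝ) (z : X) :
    |f (x + σ * T z) - (∫ z, f (x + σ * T z) ∂ν) - f' x * (σ * T z)|
      ≤ L * σ ^ 2 * (T z ^ 2 + A) := by
  have hc := hf.cont
  have hi : Integrable (fun z => f (x + σ * T z)) ν :=
    integrable_of_continuous_bounded (by fun_prop) fun z => hf.abs_apply_le hε _
  have h1 : (∫ z, f (x + σ * T z) ∂ν) - f x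
      = ∫ z, (f (x + σ * T z) - f x - f' x * (σ * T z)) ∂ν := by
    have h3 : Integrable (fun z => f (x + σ * T z) - f x) ν := hi.sub (integrable_const _)
    rw [integral_sub h3 ((hT1.const_mul σ).const_mul _), integral_sub hi (integrable_const _),
      integral_const_mul, integral_const_mul, h0]
    simp
  have h2 : |(∫ z, f (x + σ * T z) ∂ν) - f x| ≤ L * σ ^ 2 * A := by
    rw [h1]
    have := norm_integral_le_of_norm_le (μ := ν)
      (f := fun z => f (x + σ * T z) - f x - f' x * (σ * T z))
      (g := fun z => L * σ ^ 2 * T z ^ 2) (hT2.const_mul _)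
      (Eventually.of_forall fun z => by
        have := hf.taylor x (σ * T z)
        rw [Real.norm_eq_abs]
        refine this.trans_eq (by ring))
    rwa [integral_const_mul, hA] at this
  have h3 := hf.taylor x (σ * T z)
  have h4 : f (x + σ * T z) - (∫ z, f (x + σ * T z) ∂ν) - f' x * (σ * T z)
      = (f (x + σ * T z) - f x - f' x * (σ * T z)) - ((∫ z, f (x + σ * T z) ∂ν) - f x) := by ring
  rw [h4]
  refine (abs_sub _ _).trans ?_
  calc _ ≤ L * (σ * T z) ^ 2 + L * σ ^ 2 * A := add_le_add h3 h2
    _ = _ := by ring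

/-- The covariance condition says that the square of the cross term is at most the product s t of
the diagonal terms, and the arithmetic–geometric mean inequality concludes. This is the only place
where the condition is used in the short-time estimate. -/
theorem quadratic_form_nonpos {a b A B D α β : ℝ} (ha : 0 < a) (ha1 : a < 1) (hb : 0 < b)
    (hb1 : b < 1) (hA : 0 ≤ A) (hD : 0 ≤ D) (h : a * b * B ^ 2 ≤ (1 - a) * (1 - b) * (A * D)) :
    a * b * (α * β * B) - a * (1 - a) / 2 * (α ^ 2 * A) - b * (1 - b) / 2 * (β ^ 2 * D) ≤ 0 := by
  set s := a * (1 - a) * (α ^ 2 * A) with hs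
  set t := b * (1 - b) * (β ^ 2 * D) with ht
  set u := a * b * (α * β * B) with hu
  have h1a : 0 < 1 - a := by linarith
  have h1b : 0 < 1 - b := by linarith
  have hs0 : 0 ≤ s := by positivity
  have ht0 : 0 ≤ t := by positivity
  have hust : u ^ 2 ≤ s * t := by
    have h2 : 0 ≤ a * b * (α * β) ^ 2 := by positivity
    calc u ^ 2 = a * b * (α * β) ^ 2 * (a * b * B ^ 2) := by rw [hu]; ring
      _ ≤ a * b * (α * β) ^ 2 * ((1 - a) * (1 - b) * (A * D)) := by gcongr
      _ = s * t := by rw [hs, ht]; ring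
  have hu2 : u ≤ (s + t) / 2 :=
    le_of_abs_le (abs_le_of_sq_le_sq (by nlinarith [sq_nonneg (s - t)]) (by linarith))
  linarith

theorem IsPinched.div_sub_one_bounds {ε M L m : ℝ} {f f' : ℝ → ℝ} (hf : IsPinched ε M L f f')
    (hε : 0 < ε) (hm : ε ≤ m) (x : ℝ) :
    -1 ≤ f x / m - 1 ∧ |f x / m - 1| ≤ 1 + M / ε := by
  have hm0 : 0 < m := hε.trans_le hm
  have h0 : 0 ≤ f x / m := div_nonneg (hε.le.trans (hf.lower x)) hm0.le
  have h1 : f x / m ≤ M / ε := by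
    have := hf.upper x
    have h2 : 0 ≤ M := (hε.le.trans (hf.lower x)).trans this
    gcongr
  exact ⟨by linarith, by rw [abs_le]; constructor <;> linarith⟩

theorem sq_add_le_mul_sq {t A c W : ℝ} (ht : |t| ≤ W) (hW : 1 ≤ W) (hA : 0 ≤ A) (hc : 1 + A ≤ c) :
    t ^ 2 + A ≤ c * W ^ 2 := by
  have q1 : t ^ 2 ≤ W ^ 2 := sq_le_sq' (by linarith [neg_abs_le t]) ((le_abs_self t).trans ht)
  have q2 : (1 : ℝ) ≤ W ^ 2 := one_le_pow₀ hW
  nlinarith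

set_option maxHeartbeats 1000000 in
/-- Short-time form of the two-function hypercontractive inequality. -/
theorem IsStablePair.short_time {ν : Measure (ℝ × ℝ)} [IsProbabilityMeasure ν] {A B D a b : ℝ}
    (hν : IsStablePair ν A B D) (ha : 0 < a) (ha1 : a < 1) (hb : 0 < b) (hb1 : b < 1)
    (hAB : a * b * B ^ 2 ≤ (1 - a) * (1 - b) * (A * D)) {ε : ℝ} (hε : 0 < ε) (M L : ℝ) :
    ∃ C, ∀ σ : ℝ, 0 ≤ σ → σ ≤ 1 → ∀ f f' g g' : ℝ → ℝ, IsPinched ε M L f f' → IsPinched ε M L g g' →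
      ∀ x y : ℝ, ∫ z, f (x + σ * z.1) ^ a * g (y + σ * z.2) ^ b ∂ν ≤
        (∫ z, f (x + σ * z.1) ∂ν) ^ a * (∫ z, g (y + σ * z.2) ∂ν) ^ b + C * σ ^ 3 := by
  have hA : 0 ≤ A := hν.var_fst ▸ integral_nonneg fun z => sq_nonneg _
  have hD : 0 ≤ D := hν.var_snd ▸ integral_nonneg fun z => sq_nonneg _
  -- All constants depend only on ε, M, L, the exponents and ν, never on the functions, the base
  -- points or σ; the iteration needs this uniformity.
  set κ := L / ε * (1 + A + D) with hκ
  set N := 1 + M / ε with hN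
  set C₀ := (5 + 4 * N + N ^ 3) * (2 * κ) ^ 3 + 9 * κ ^ 2 with hC₀
  set I := ∫ z : ℝ × ℝ, (1 + |z.1| + |z.2|) ^ 6 ∂ν with hI
  refine ⟨M ^ a * M ^ b * (C₀ * I), fun σ hσ hσ1 f f' g g' hf hg x y => ?_⟩
  have hL : 0 ≤ L := (abs_nonneg _).trans (hf.bound' 0)
  have hM : 0 ≤ M := hε.le.trans ((hf.lower 0).trans (hf.upper 0))
  have hκ0 : 0 ≤ κ := by positivity
  have hN0 : 0 ≤ N := by positivity
  have hF : IsPinched ε M L (fun x => ∫ z : ℝ × ℝ, f (x + σ * z.1) ∂ν) _ :=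
    hf.average hε (T := fun z : ℝ × ℝ => σ * z.1) (by fun_prop)
  have hG : IsPinched ε M L (fun x => ∫ z : ℝ × ℝ, g (x + σ * z.2) ∂ν) _ :=
    hg.average hε (T := fun z : ℝ × ℝ => σ * z.2) (by fun_prop)
  have hmε := hF.lower x
  have hmM := hF.upper x
  have hnε := hG.lower y
  have hnM := hG.upper y
  have hdev := hf.deviation hε continuous_fst hν.integrable_fst hν.integrable_fst_sq hν.mean_fst
    hν.var_fst σ x
  have hdev' := hg.deviation hε continuous_snd hν.integrable_snd hν.integrable_snd_sq hν.mean_snd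
    hν.var_snd σ y
  have hcf := hf.cont
  have hcg := hg.cont
  have hif : Integrable (fun z : ℝ × ℝ => f (x + σ * z.1)) ν :=
    integrable_of_continuous_bounded (by fun_prop) fun z => hf.abs_apply_le hε _
  have hig : Integrable (fun z : ℝ × ℝ => g (y + σ * z.2)) ν :=
    integrable_of_continuous_bounded (by fun_prop) fun z => hg.abs_apply_le hε _
  set m := ∫ z : ℝ × ℝ, f (x + σ * z.1) ∂ν with hm
  set n := ∫ z : ℝ × ℝ, g (y + σ * z.2) ∂ν with hn
  have hm0 : 0 < m := hε.trans_le hmε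
  have hn0 : 0 < n := hε.trans_le hnε
  set α := f' x / m with hα
  set β := g' y / n with hβ
  have habs : ∀ c k : ℝ, ε ≤ k → |c| ≤ L → |c / k| ≤ L / ε := by
    intro c k hk hc
    rw [abs_div, abs_of_pos (hε.trans_le hk)]
    gcongr
  -- The expansion is around the averages m and n rather than f x and g y, so that the linear terms
  -- integrate to exactly zero.
  set R : ℝ × ℝ → ℝ := fun z => 1 + a * (f (x + σ * z.1) / m - 1) + b * (g (y + σ * z.2) / n - 1)
      + σ ^ 2 * (a * b * (α * β * (z.1 * z.2)) - a * (1 - a) / 2 * (α ^ 2 * z.1 ^ 2)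
        - b * (1 - b) / 2 * (β ^ 2 * z.2 ^ 2)) + C₀ * σ ^ 3 * (1 + |z.1| + |z.2|) ^ 6 with hR
  have hpt : ∀ z : ℝ × ℝ, f (x + σ * z.1) ^ a * g (y + σ * z.2) ^ b ≤ m ^ a * n ^ b * R z := by
    intro z
    have hW : 1 ≤ 1 + |z.1| + |z.2| := by linarith [abs_nonneg z.1, abs_nonneg z.2]
    have hb1' := hf.div_sub_one_bounds hε hmε (x + σ * z.1)
    have hb2' := hg.div_sub_one_bounds hε hnε (y + σ * z.2)
    have n1 : |f (x + σ * z.1) / m - 1 - σ * (α * z.1)|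
        ≤ κ * σ ^ 2 * (1 + |z.1| + |z.2|) ^ 2 := by
      have e1 : f (x + σ * z.1) / m - 1 - σ * (α * z.1)
          = (f (x + σ * z.1) - m - f' x * (σ * z.1)) / m := by rw [hα]; field_simp
      rw [e1, abs_div, abs_of_pos hm0, div_le_iff₀ hm0]
      refine (hdev z).trans ?_
      have hz : z.1 ^ 2 + A ≤ (1 + A + D) * (1 + |z.1| + |z.2|) ^ 2 :=
        sq_add_le_mul_sq (by linarith [abs_nonneg z.2]) hW hA (by linarith)
      calc L * σ ^ 2 * (z.1 ^ 2 + A)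
          ≤ L * σ ^ 2 * ((1 + A + D) * (1 + |z.1| + |z.2|) ^ 2) := by gcongr
        _ = κ * σ ^ 2 * (1 + |z.1| + |z.2|) ^ 2 * ε := by rw [hκ]; field_simp
        _ ≤ _ := by gcongr
    have n2 : |g (y + σ * z.2) / n - 1 - σ * (β * z.2)|
        ≤ κ * σ ^ 2 * (1 + |z.1| + |z.2|) ^ 2 := by
      have e1 : g (y + σ * z.2) / n - 1 - σ * (β * z.2)
          = (g (y + σ * z.2) - n - g' y * (σ * z.2)) / n := by rw [hβ]; field_simp
      rw [e1, abs_div, abs_of_pos hn0, div_le_iff₀ hn0]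
      refine (hdev' z).trans ?_
      have hz : z.2 ^ 2 + D ≤ (1 + A + D) * (1 + |z.1| + |z.2|) ^ 2 :=
        sq_add_le_mul_sq (by linarith [abs_nonneg z.1]) hW hD (by linarith)
      calc L * σ ^ 2 * (z.2 ^ 2 + D)
          ≤ L * σ ^ 2 * ((1 + A + D) * (1 + |z.1| + |z.2|) ^ 2) := by gcongr
        _ = κ * σ ^ 2 * (1 + |z.1| + |z.2|) ^ 2 * ε := by rw [hκ]; field_simp
        _ ≤ _ := by gcongr
    have hLκ : L / ε ≤ κ := by
      rw [hκ]
      exact le_mul_of_one_le_right (by positivity) (by linarith)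
    have n3 : |α * z.1| ≤ κ * (1 + |z.1| + |z.2|) := by
      rw [abs_mul]
      exact mul_le_mul ((habs _ _ hmε (hf.bound' x)).trans hLκ) (by linarith [abs_nonneg z.2])
        (abs_nonneg _) hκ0
    have n4 : |β * z.2| ≤ κ * (1 + |z.1| + |z.2|) := by
      rw [abs_mul]
      exact mul_le_mul ((habs _ _ hnε (hg.bound' y)).trans hLκ) (by linarith [abs_nonneg z.1])
        (abs_nonneg _) hκ0
    have key := one_add_rpow_mul_le_of_near ha ha1 hb hb1 hb1'.1 hb2'.1 hb1'.2 hb2'.2 hκ0 hσ hσ1 hW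
      n1 n2 n3 n4
    have e2 : f (x + σ * z.1) ^ a * g (y + σ * z.2) ^ b = m ^ a * n ^ b *
        ((1 + (f (x + σ * z.1) / m - 1)) ^ a * (1 + (g (y + σ * z.2) / n - 1)) ^ b) := by
      rw [add_sub_cancel, add_sub_cancel, Real.div_rpow (hε.le.trans (hf.lower _)) hm0.le,
        Real.div_rpow (hε.le.trans (hg.lower _)) hn0.le]
      have := Real.rpow_pos_of_pos hm0 a
      have := Real.rpow_pos_of_pos hn0 b
      field_simp
    rw [e2]
    refine mul_le_mul_of_nonneg_left (key.trans_eq ?_) (by positivity)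
    simp only [hR]
    ring
  have i1 : Integrable (fun z : ℝ × ℝ => a * (f (x + σ * z.1) / m - 1)) ν :=
    ((hif.div_const m).sub (integrable_const 1)).const_mul a
  have i2 : Integrable (fun z : ℝ × ℝ => b * (g (y + σ * z.2) / n - 1)) ν :=
    ((hig.div_const n).sub (integrable_const 1)).const_mul b
  have i3 : Integrable (fun z : ℝ × ℝ => a * b * (α * β * (z.1 * z.2))) ν :=
    (hν.integrable_mul.const_mul _).const_mul _
  have i4 : Integrable (fun z : ℝ × ℝ => a * (1 - a) / 2 * (α ^ 2 * z.1 ^ 2)) ν :=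
    (hν.integrable_fst_sq.const_mul _).const_mul _
  have i5 : Integrable (fun z : ℝ × ℝ => b * (1 - b) / 2 * (β ^ 2 * z.2 ^ 2)) ν :=
    (hν.integrable_snd_sq.const_mul _).const_mul _
  have i34 : Integrable (fun z : ℝ × ℝ => a * b * (α * β * (z.1 * z.2))
      - a * (1 - a) / 2 * (α ^ 2 * z.1 ^ 2)) ν := i3.sub i4
  have i345 : Integrable (fun z : ℝ × ℝ => σ ^ 2 * (a * b * (α * β * (z.1 * z.2))
      - a * (1 - a) / 2 * (α ^ 2 * z.1 ^ 2) - b * (1 - b) / 2 * (β ^ 2 * z.2 ^ 2))) ν :=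
    (i34.sub i5).const_mul _
  have i6 : Integrable (fun z : ℝ × ℝ => C₀ * σ ^ 3 * (1 + |z.1| + |z.2|) ^ 6) ν :=
    hν.moment.const_mul _
  have i01 : Integrable (fun z : ℝ × ℝ => 1 + a * (f (x + σ * z.1) / m - 1)) ν :=
    (integrable_const 1).add i1
  have i012 : Integrable (fun z : ℝ × ℝ => 1 + a * (f (x + σ * z.1) / m - 1)
      + b * (g (y + σ * z.2) / n - 1)) ν := i01.add i2
  have iall : Integrable (fun z : ℝ × ℝ => 1 + a * (f (x + σ * z.1) / m - 1)
      + b * (g (y + σ * z.2) / n - 1) + σ ^ 2 * (a * b * (α * β * (z.1 * z.2))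
      - a * (1 - a) / 2 * (α ^ 2 * z.1 ^ 2) - b * (1 - b) / 2 * (β ^ 2 * z.2 ^ 2))) ν :=
    i012.add i345
  have hRi : Integrable R ν := iall.add i6
  have hz1 : ∫ z : ℝ × ℝ, a * (f (x + σ * z.1) / m - 1) ∂ν = 0 := by
    rw [integral_const_mul, integral_sub (hif.div_const m) (integrable_const 1), integral_div, ← hm]
    simp [hm0.ne']
  have hz2 : ∫ z : ℝ × ℝ, b * (g (y + σ * z.2) / n - 1) ∂ν = 0 := by
    rw [integral_const_mul, integral_sub (hig.div_const n) (integrable_const 1), integral_div, ← hn]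
    simp [hn0.ne']
  have hRint : ∫ z, R z ∂ν ≤ 1 + C₀ * σ ^ 3 * I := by
    simp only [hR]
    rw [integral_add iall i6, integral_add i012 i345, integral_add i01 i2,
      integral_add (integrable_const 1) i1, hz1, hz2, integral_const_mul, integral_sub i34 i5,
      integral_sub i3 i4]
    simp only [integral_const_mul]
    rw [hν.var_fst, hν.var_snd, hν.cov, ← hI]
    have := quadratic_form_nonpos (α := α) (β := β) ha ha1 hb hb1 hA hD hAB
    have h2 := mul_nonpos_of_nonneg_of_nonpos (sq_nonneg σ) this
    simp only [integral_const, probReal_univ, smul_eq_mul, mul_one, add_zero]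
    linarith
  have hI0 : 0 ≤ I := integral_nonneg fun z => by positivity
  have hC0 : 0 ≤ C₀ := by positivity
  calc ∫ z, f (x + σ * z.1) ^ a * g (y + σ * z.2) ^ b ∂ν
      ≤ ∫ z, m ^ a * n ^ b * R z ∂ν := by
        refine integral_mono_of_nonneg (Eventually.of_forall fun z => ?_) (hRi.const_mul _)
          (Eventually.of_forall hpt)
        exact mul_nonneg (Real.rpow_nonneg (hε.le.trans (hf.lower _)) _)
          (Real.rpow_nonneg (hε.le.trans (hg.lower _)) _)
    _ = m ^ a * n ^ b * ∫ z, R z ∂ν := integral_const_mul _ _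
    _ ≤ m ^ a * n ^ b * (1 + C₀ * σ ^ 3 * I) := by gcongr
    _ = m ^ a * n ^ b + m ^ a * n ^ b * (C₀ * I) * σ ^ 3 := by ring
    _ ≤ m ^ a * n ^ b + M ^ a * M ^ b * (C₀ * I) * σ ^ 3 := by gcongr

/-! ### Doubling, and the passage from short times to scale one -/

/-- Stability writes the integral at scale √2 σ as an iterated integral at scale σ. The hypothesis
is applied to f, g inside, then to their averages outside, which are pinched with the same
constants; each application costs e. -/
theorem IsStablePair.doubling {ν : Measure (ℝ × ℝ)} [IsProbabilityMeasure ν] {A B D a b : ℝ}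
    (hν : IsStablePair ν A B D) (ha : 0 < a) (hb : 0 < b) {ε M L e σ : ℝ} (hε : 0 < ε)
    (h : ∀ f f' g g' : ℝ → ℝ, IsPinched ε M L f f' → IsPinched ε M L g g' →
      ∀ x y : ℝ, ∫ z, f (x + σ * z.1) ^ a * g (y + σ * z.2) ^ b ∂ν ≤
        (∫ z, f (x + σ * z.1) ∂ν) ^ a * (∫ z, g (y + σ * z.2) ∂ν) ^ b + e) :
    ∀ f f' g g' : ℝ → ℝ, IsPinched ε M L f f' → IsPinched ε M L g g' →
      ∀ x y : ℝ, ∫ z, f (x + √2 * σ * z.1) ^ a * g (y + √2 * σ * z.2) ^ b ∂ν ≤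
        (∫ z, f (x + √2 * σ * z.1) ∂ν) ^ a * (∫ z, g (y + √2 * σ * z.2) ∂ν) ^ b + 2 * e := by
  intro f f' g g' hf hg x y
  have hcf := hf.cont
  have hcg := hg.cont
  have hF : IsPinched ε M L (fun x => ∫ z : ℝ × ℝ, f (x + σ * z.1) ∂ν) _ :=
    hf.average hε (T := fun z : ℝ × ℝ => σ * z.1) (by fun_prop)
  have hG : IsPinched ε M L (fun x => ∫ z : ℝ × ℝ, g (x + σ * z.2) ∂ν) _ :=
    hg.average hε (T := fun z : ℝ × ℝ => σ * z.2) (by fun_prop)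
  have hprodc : ∀ {u v : ℝ → ℝ}, Continuous u → Continuous v →
      Continuous (fun z : ℝ × ℝ => u z.1 ^ a * v z.2 ^ b) := fun hu hv =>
    ((hu.comp continuous_fst).rpow_const fun _ => Or.inr ha.le).mul
      ((hv.comp continuous_snd).rpow_const fun _ => Or.inr hb.le)
  have hprodb : ∀ {u u' v v' : ℝ → ℝ}, IsPinched ε M L u u' → IsPinched ε M L v v' → ∀ s t,
      |u s ^ a * v t ^ b| ≤ M ^ a * M ^ b := by
    intro u u' v v' hu hv s t
    have h1 := hε.le.trans (hu.lower s)
    have h2 := hε.le.trans (hv.lower t)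
    have hM := h1.trans (hu.upper s)
    rw [abs_of_nonneg (by positivity)]
    exact mul_le_mul (Real.rpow_le_rpow h1 (hu.upper s) ha.le)
      (Real.rpow_le_rpow h2 (hv.upper t) hb.le) (by positivity) (by positivity)
  have s1 := hν.stable (fun z => f (x + σ * z.1) ^ a * g (y + σ * z.2) ^ b)
    (hprodc (u := fun s => f (x + σ * s)) (v := fun s => g (y + σ * s)) (by fun_prop) (by fun_prop))
    ⟨_, fun z => hprodb hf hg _ _⟩
  have s2 := hν.stable (fun z => f (x + σ * z.1)) (by fun_prop) ⟨M, fun z => hf.abs_apply_le hε _⟩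
  have s3 := hν.stable (fun z => g (y + σ * z.2)) (by fun_prop) ⟨M, fun z => hg.abs_apply_le hε _⟩
  have r1 : ∀ t : ℝ, σ * (√2 * t) = √2 * σ * t := fun t => by ring
  have r2 : ∀ t s u : ℝ, u + σ * (t + s) = u + σ * t + σ * s := fun t s u => by ring
  simp only [r1, r2] at s1 s2 s3
  rw [s1, s2, s3]
  have hout := h _ _ _ _ hF hG x y
  have hcont : Continuous fun z : ℝ × ℝ => (∫ z' : ℝ × ℝ, f (x + σ * z.1 + σ * z'.1) ∂ν) ^ a *
      (∫ z' : ℝ × ℝ, g (y + σ * z.2 + σ * z'.2) ∂ν) ^ b :=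
    hprodc (hF.cont.comp (by fun_prop : Continuous fun s : ℝ => x + σ * s))
      (hG.cont.comp (by fun_prop : Continuous fun s : ℝ => y + σ * s))
  have hinteg := integrable_of_continuous_bounded (ν := ν) hcont (fun z => hprodb hF hG _ _)
  have hle : ∫ z : ℝ × ℝ, ∫ z' : ℝ × ℝ, f (x + σ * z.1 + σ * z'.1) ^ a *
      g (y + σ * z.2 + σ * z'.2) ^ b ∂ν ∂ν ≤
      ∫ z : ℝ × ℝ, ((∫ z' : ℝ × ℝ, f (x + σ * z.1 + σ * z'.1) ∂ν) ^ a *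
      (∫ z' : ℝ × ℝ, g (y + σ * z.2 + σ * z'.2) ∂ν) ^ b + e) ∂ν := by
    refine integral_mono_of_nonneg (Eventually.of_forall fun z => integral_nonneg fun z' => ?_)
      (hinteg.add (integrable_const e)) (Eventually.of_forall fun z => h f f' g g' hf hg _ _)
    exact mul_nonneg (Real.rpow_nonneg (hε.le.trans (hf.lower _)) _)
      (Real.rpow_nonneg (hε.le.trans (hg.lower _)) _)
  rw [integral_add hinteg (integrable_const e)] at hle
  simp only [integral_const, probReal_univ, smul_eq_mul, one_mul] at hle
  linarith

/-- The two-function hypercontractive inequality for pinched functions. -/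
theorem IsStablePair.integral_rpow_mul_le {ν : Measure (ℝ × ℝ)} [IsProbabilityMeasure ν]
    {A B D a b : ℝ} (hν : IsStablePair ν A B D) (ha : 0 < a) (ha1 : a < 1) (hb : 0 < b) (hb1 : b < 1)
    (hAB : a * b * B ^ 2 ≤ (1 - a) * (1 - b) * (A * D)) {ε M L : ℝ} (hε : 0 < ε)
    {f f' g g' : ℝ → ℝ} (hf : IsPinched ε M L f f') (hg : IsPinched ε M L g g') :
    ∫ z, f z.1 ^ a * g z.2 ^ b ∂ν ≤ (∫ z, f z.1 ∂ν) ^ a * (∫ z, g z.2 ∂ν) ^ b := by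
  obtain ⟨C, hC⟩ := hν.short_time ha ha1 hb hb1 hAB hε M L
  have iter : ∀ (k : ℕ) (σ e : ℝ), (∀ f f' g g' : ℝ → ℝ, IsPinched ε M L f f' → IsPinched ε M L g g' →
      ∀ x y : ℝ, ∫ z, f (x + σ * z.1) ^ a * g (y + σ * z.2) ^ b ∂ν ≤
        (∫ z, f (x + σ * z.1) ∂ν) ^ a * (∫ z, g (y + σ * z.2) ∂ν) ^ b + e) →
      ∀ f f' g g' : ℝ → ℝ, IsPinched ε M L f f' → IsPinched ε M L g g' →
      ∀ x y : ℝ, ∫ z, f (x + √2 ^ k * σ * z.1) ^ a * g (y + √2 ^ k * σ * z.2) ^ b ∂ν ≤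
        (∫ z, f (x + √2 ^ k * σ * z.1) ∂ν) ^ a * (∫ z, g (y + √2 ^ k * σ * z.2) ∂ν) ^ b
          + 2 ^ k * e := by
    intro k
    induction k with
    | zero => intro σ e h; simpa using h
    | succ k ih =>
      intro σ e h
      have := ih (√2 * σ) (2 * e) (hν.doubling ha hb hε h)
      have e1 : √2 ^ k * (√2 * σ) = √2 ^ (k + 1) * σ := by ring
      have e2 : (2 : ℝ) ^ k * (2 * e) = 2 ^ (k + 1) * e := by ring
      simpa only [e1, e2] using this
  have h2 : (1 : ℝ) < √2 := by
    rw [Real.lt_sqrt] <;> norm_num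
  have hk : ∀ k : ℕ, ∫ z, f z.1 ^ a * g z.2 ^ b ∂ν ≤
      (∫ z, f z.1 ∂ν) ^ a * (∫ z, g z.2 ∂ν) ^ b + C * (√2)⁻¹ ^ k := by
    intro k
    have h2k : (0 : ℝ) < √2 ^ k := by positivity
    -- Starting at scale 2^{-k/2}, the error 2^k · C · 2^{-3k/2} is C · 2^{-k/2}; any remainder of
    -- order better than σ² would do.
    have := iter k ((√2 ^ k)⁻¹) (C * ((√2 ^ k)⁻¹) ^ 3)
      (hC _ (by positivity) (inv_le_one_of_one_le₀ (one_le_pow₀ h2.le))) f f' g g' hf hg 0 0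
    rw [mul_inv_cancel₀ h2k.ne'] at this
    simp only [zero_add, one_mul] at this
    refine this.trans_eq ?_
    have e3 : (2 : ℝ) ^ k = (√2 ^ k) ^ 2 := by
      rw [← pow_mul, mul_comm, pow_mul, Real.sq_sqrt (by norm_num)]
    congr 1
    rw [e3, inv_pow √2]
    generalize √2 ^ k = s at *
    field_simp
  have hlim : Tendsto (fun k : ℕ => (∫ z, f z.1 ∂ν) ^ a * (∫ z, g z.2 ∂ν) ^ b + C * (√2)⁻¹ ^ k) atTop
      (𝓝 ((∫ z, f z.1 ∂ν) ^ a * (∫ z, g z.2 ∂ν) ^ b + C * 0)) :=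
    ((tendsto_pow_atTop_nhds_zero_of_lt_one (by positivity)
      (inv_lt_one_of_one_lt₀ h2)).const_mul C).const_add _
  rw [mul_zero, add_zero] at hlim
  exact ge_of_tendsto' hlim hk

/-! ### Gaussian pairs are stable -/

theorem continuous_integral_of_bounded {X Y : Type*} [TopologicalSpace X] [FirstCountableTopology X]
    [TopologicalSpace Y] [MeasurableSpace Y] [OpensMeasurableSpace Y] [SecondCountableTopology Y]
    {ρ : Measure Y} [IsFiniteMeasure ρ] {Φ : X → Y → ℝ} (hc : Continuous (Function.uncurry Φ)) {M : ℝ}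
    (hM : ∀ x y, |Φ x y| ≤ M) : Continuous fun x => ∫ y, Φ x y ∂ρ :=
  continuous_of_dominated (bound := fun _ => M)
    (fun x => (hc.comp (by fun_prop : Continuous fun y => (x, y))).aestronglyMeasurable)
    (fun x => Eventually.of_forall (hM x)) (integrable_const M)
    (Eventually.of_forall fun y => hc.comp (by fun_prop : Continuous fun x => (x, y)))

theorem abs_integral_le_of_bounded {Y : Type*} [MeasurableSpace Y] {ρ : Measure Y}
    [IsProbabilityMeasure ρ] {φ : Y → ℝ} {M : ℝ} (hM : ∀ y, |φ y| ≤ M) : |∫ y, φ y ∂ρ| ≤ M := by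
  simpa using norm_integral_le_of_norm_le_const (μ := ρ) (f := φ) (C := M) (Eventually.of_forall hM)

namespace ProbabilityTheory

open scoped NNReal

theorem integral_gaussianReal_sqrt_two_mul (v : ℝ≥0) {φ : ℝ → ℝ} (hφ : Continuous φ) {M : ℝ}
    (hM : ∀ x, |φ x| ≤ M) :
    ∫ x, φ (√2 * x) ∂gaussianReal 0 v = ∫ x, ∫ y, φ (x + y) ∂gaussianReal 0 v ∂gaussianReal 0 v := by
  have h1 : (gaussianReal 0 v).map (√2 * ·) = gaussianReal 0 v ∗ gaussianReal 0 v := by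
    rw [gaussianReal_map_const_mul, gaussianReal_conv_gaussianReal, mul_zero, add_zero]
    congr 1
    ext
    simp
    ring
  rw [← integral_conv (integrable_of_continuous_bounded hφ hM), ← h1,
    integral_map (by fun_prop) hφ.aestronglyMeasurable]

theorem integral_sq_gaussianReal (v : ℝ≥0) : ∫ x, x ^ 2 ∂gaussianReal 0 v = v := by
  rw [← variance_of_integral_eq_zero (X := fun x => x) (by fun_prop) integral_id_gaussianReal,
    variance_fun_id_gaussianReal]

theorem integrable_gaussianReal_one_add_abs_pow (v : ℝ≥0) (n : ℕ) :
    Integrable (fun x : ℝ => (1 + |x|) ^ n) (gaussianReal 0 v) := by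
  have h0 : MemLp (fun x : ℝ => |x|) n (gaussianReal 0 v) :=
    (memLp_id_gaussianReal' n (by simp)).norm
  have h1 : MemLp (fun x : ℝ => 1 + |x|) n (gaussianReal 0 v) := (memLp_const (1 : ℝ)).add h0
  refine h1.integrable_norm_pow'.congr (Eventually.of_forall fun x => ?_)
  simp only
  rw [Real.norm_of_nonneg (by positivity)]

/-- The joint law of `(X, c X + U)` with `X ~ N(0, v)` and `U ~ N(0, w)` independent. -/
noncomputable def gaussianPair (v w : ℝ≥0) (c : ℝ) : Measure (ℝ × ℝ) :=
  ((gaussianReal 0 v).prod (gaussianReal 0 w)).map fun z => (z.1, c * z.1 + z.2)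

instance (v w : ℝ≥0) (c : ℝ) : IsProbabilityMeasure (gaussianPair v w c) :=
  Measure.isProbabilityMeasure_map (by fun_prop)

theorem integral_gaussianPair (v w : ℝ≥0) (c : ℝ) {φ : ℝ × ℝ → ℝ} (hφ : Continuous φ) :
    ∫ z, φ z ∂gaussianPair v w c =
      ∫ z, φ (z.1, c * z.1 + z.2) ∂(gaussianReal 0 v).prod (gaussianReal 0 w) :=
  integral_map (by fun_prop) hφ.aestronglyMeasurable

theorem isStablePair_gaussianPair (v w : ℝ≥0) (c : ℝ) :
    IsStablePair (gaussianPair v w c) v (c * v) (c ^ 2 * v + w) := by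
  have hx : Integrable (fun x : ℝ => x) (gaussianReal 0 v) :=
    memLp_one_iff_integrable.1 (memLp_id_gaussianReal' 1 (by simp))
  have hu : Integrable (fun x : ℝ => x) (gaussianReal 0 w) :=
    memLp_one_iff_integrable.1 (memLp_id_gaussianReal' 1 (by simp))
  have hx2 : Integrable (fun x : ℝ => x ^ 2) (gaussianReal 0 v) :=
    (memLp_id_gaussianReal' 2 (by simp)).integrable_sq
  have hu2 : Integrable (fun x : ℝ => x ^ 2) (gaussianReal 0 w) :=
    (memLp_id_gaussianReal' 2 (by simp)).integrable_sq
  have m1 : ∫ x : ℝ, x ∂gaussianReal 0 v = 0 := integral_id_gaussianReal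
  have m2 : ∫ x : ℝ, x ∂gaussianReal 0 w = 0 := integral_id_gaussianReal
  set P := (gaussianReal 0 v).prod (gaussianReal 0 w) with hP
  have jx : Integrable (fun z : ℝ × ℝ => z.1) P := hx.comp_fst _
  have ju : Integrable (fun z : ℝ × ℝ => z.2) P := hu.comp_snd _
  have jx2 : Integrable (fun z : ℝ × ℝ => z.1 ^ 2) P := hx2.comp_fst _
  have ju2 : Integrable (fun z : ℝ × ℝ => z.2 ^ 2) P := hu2.comp_snd _
  have jxu : Integrable (fun z : ℝ × ℝ => z.1 * z.2) P := hx.mul_prod hu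
  have k1 : ∫ z, z.1 ∂P = 0 := by
    rw [hP, integral_fun_fst (fun x : ℝ => x), m1, smul_zero]
  have k2 : ∫ z, z.2 ∂P = 0 := by
    rw [hP, integral_fun_snd (fun x : ℝ => x), m2, smul_zero]
  have k3 : ∫ z, z.1 ^ 2 ∂P = v := by
    rw [hP, integral_fun_fst (fun x : ℝ => x ^ 2), integral_sq_gaussianReal]; simp
  have k4 : ∫ z, z.2 ^ 2 ∂P = w := by
    rw [hP, integral_fun_snd (fun x : ℝ => x ^ 2), integral_sq_gaussianReal]; simp
  have k5 : ∫ z, z.1 * z.2 ∂P = 0 := by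
    rw [hP, integral_prod_mul (fun x : ℝ => x) (fun x : ℝ => x), m1, zero_mul]
  refine ⟨?_, ?_, ?_, ?_, ?_, ?_, ?_⟩
  · refine (integrable_map_measure (by fun_prop) (by fun_prop)).2 ?_
    have h1 := ((integrable_gaussianReal_one_add_abs_pow v 6).mul_prod
      (integrable_gaussianReal_one_add_abs_pow w 6)).const_mul ((1 + |c|) ^ 6)
    refine h1.mono' (by fun_prop) (Eventually.of_forall fun z => ?_)
    simp only [Function.comp]
    rw [Real.norm_of_nonneg (by positivity), ← mul_pow, ← mul_pow]
    gcongr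
    have h2 : |c * z.1 + z.2| ≤ |c| * |z.1| + |z.2| := by
      rw [← abs_mul]; exact abs_add_le _ _
    nlinarith [mul_nonneg (abs_nonneg z.1) (abs_nonneg z.2),
      mul_nonneg (abs_nonneg c) (mul_nonneg (abs_nonneg z.1) (abs_nonneg z.2)),
      mul_nonneg (abs_nonneg c) (abs_nonneg z.2), abs_nonneg c]
  · rw [integral_gaussianPair _ _ _ continuous_fst, k1]
  · rw [integral_gaussianPair _ _ _ continuous_snd, integral_add (jx.const_mul c) ju,
      integral_const_mul, k1, k2]
    simp
  · rw [integral_gaussianPair _ _ _ (by fun_prop), k3]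
  · rw [integral_gaussianPair _ _ _ (by fun_prop)]
    have e1 : ∀ z : ℝ × ℝ, z.1 * (c * z.1 + z.2) = c * z.1 ^ 2 + z.1 * z.2 := fun z => by ring
    simp only [e1]
    rw [integral_add (jx2.const_mul c) jxu, integral_const_mul, k3, k5, add_zero]
  · rw [integral_gaussianPair _ _ _ (by fun_prop)]
    have e1 : ∀ z : ℝ × ℝ, (c * z.1 + z.2) ^ 2 = (c ^ 2 * z.1 ^ 2 + 2 * c * (z.1 * z.2)) + z.2 ^ 2 :=
      fun z => by ring
    have j2 : Integrable (fun z : ℝ × ℝ => c ^ 2 * z.1 ^ 2 + 2 * c * (z.1 * z.2)) P :=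
      (jx2.const_mul _).add (jxu.const_mul _)
    simp only [e1]
    rw [integral_add j2 ju2, integral_add (jx2.const_mul _) (jxu.const_mul _), integral_const_mul,
      integral_const_mul, k3, k4, k5, mul_zero, add_zero]
  · rintro Ψ hΨ ⟨M, hM⟩
    have c1 : Continuous fun z : ℝ × ℝ => ∫ z', Ψ (z.1 + z'.1, z.2 + z'.2) ∂gaussianPair v w c :=
      continuous_integral_of_bounded (Φ := fun z z' : ℝ × ℝ => Ψ (z.1 + z'.1, z.2 + z'.2))
        (by fun_prop) fun z z' => hM _
    rw [integral_gaussianPair _ _ _ (by fun_prop), integral_gaussianPair _ _ _ c1]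
    have i1 : ∀ z : ℝ × ℝ, ∫ z', Ψ (z.1 + z'.1, c * z.1 + z.2 + z'.2) ∂gaussianPair v w c =
        ∫ x', ∫ u', Ψ (z.1 + x', c * z.1 + z.2 + (c * x' + u'))
          ∂gaussianReal 0 w ∂gaussianReal 0 v := by
      intro z
      rw [integral_gaussianPair _ _ _ (by fun_prop), integral_prod]
      exact integrable_of_continuous_bounded (by fun_prop) fun _ => hM _
    simp only [i1]
    have c3 : Continuous fun p : (ℝ × ℝ) × ℝ => ∫ u', Ψ (p.1.1 + p.2, c * p.1.1 + p.1.2 +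
        (c * p.2 + u')) ∂gaussianReal 0 w :=
      continuous_integral_of_bounded (Φ := fun (p : (ℝ × ℝ) × ℝ) (u' : ℝ) =>
        Ψ (p.1.1 + p.2, c * p.1.1 + p.1.2 + (c * p.2 + u'))) (by fun_prop) fun _ _ => hM _
    have c2 : Continuous fun z : ℝ × ℝ => ∫ x', ∫ u', Ψ (z.1 + x', c * z.1 + z.2 + (c * x' + u'))
          ∂gaussianReal 0 w ∂gaussianReal 0 v :=
      continuous_integral_of_bounded (Φ := fun (z : ℝ × ℝ) (x' : ℝ) =>
        ∫ u', Ψ (z.1 + x', c * z.1 + z.2 + (c * x' + u')) ∂gaussianReal 0 w)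
        c3 fun _ _ => abs_integral_le_of_bounded fun _ => hM _
    rw [integral_prod _ (integrable_of_continuous_bounded (by fun_prop) fun _ => hM _),
      integral_prod _ (integrable_of_continuous_bounded c2 fun _ =>
        abs_integral_le_of_bounded fun _ => abs_integral_le_of_bounded fun _ => hM _)]
    -- One-dimensional stability is applied to the independent part u with x fixed, and then to x.
    -- Fubini puts the four integrations in the order required.
    have s1 : ∀ x : ℝ, ∫ u, Ψ (√2 * x, √2 * (c * x + u)) ∂gaussianReal 0 w =
        ∫ u, ∫ u', Ψ (√2 * x, c * (√2 * x) + (u + u')) ∂gaussianReal 0 w ∂gaussianReal 0 w := by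
      intro x
      rw [← integral_gaussianReal_sqrt_two_mul w (φ := fun u => Ψ (√2 * x, c * (√2 * x) + u))
        (by fun_prop) fun _ => hM _]
      congr 1
      funext u
      congr 2
      ring
    simp only [s1]
    have c4 : Continuous fun s : ℝ => ∫ u, ∫ u', Ψ (s, c * s + (u + u')) ∂gaussianReal 0 w
        ∂gaussianReal 0 w := by
      refine continuous_integral_of_bounded (Φ := fun s u : ℝ =>
        ∫ u', Ψ (s, c * s + (u + u')) ∂gaussianReal 0 w) ?_ fun _ _ =>
          abs_integral_le_of_bounded fun _ => hM _
      exact continuous_integral_of_bounded (Φ := fun (p : ℝ × ℝ) (u' : ℝ) =>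
        Ψ (p.1, c * p.1 + (p.2 + u'))) (by fun_prop) fun _ _ => hM _
    rw [integral_gaussianReal_sqrt_two_mul v c4 fun _ => abs_integral_le_of_bounded fun _ =>
      abs_integral_le_of_bounded fun _ => hM _]
    congr 1
    funext x
    rw [integral_integral_swap]
    · congr 1
      funext u
      congr 1
      funext x'
      congr 1
      funext u'
      congr 2
      ring
    · refine integrable_of_continuous_bounded (M := M) ?_ fun _ =>
        abs_integral_le_of_bounded fun _ => hM _
      exact continuous_integral_of_bounded (Φ := fun (p : ℝ × ℝ) (u' : ℝ) =>
        Ψ (x + p.1, c * (x + p.1) + (p.2 + u'))) (by fun_prop) fun _ _ => hM _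

end ProbabilityTheory

/-! ### Extension from pinched to integrable functions -/

theorem IsPinched.mono {ε M L ε₁ M₁ L₁ : ℝ} {f f' : ℝ → ℝ} (hf : IsPinched ε M L f f')
    (h1 : ε₁ ≤ ε) (h2 : M ≤ M₁) (h3 : L ≤ L₁) : IsPinched ε₁ M₁ L₁ f f' where
  cont := hf.cont
  cont' := hf.cont'
  lower x := h1.trans (hf.lower x)
  upper x := (hf.upper x).trans h2
  bound' x := (hf.bound' x).trans h3
  taylor x y := (hf.taylor x y).trans (by gcongr)

/-- A smooth, positive substitute for |g|. After subtracting ε it is C² with compact support, so it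
and its first two derivatives are bounded; the mean value inequality, used twice, gives the Taylor
bound. -/
theorem exists_isPinched_sqrt {g : ℝ → ℝ} (hg : ContDiff ℝ 2 g) (hs : HasCompactSupport g) {ε : ℝ}
    (hε : 0 < ε) : ∃ M L f', IsPinched ε M L (fun x => √(g x ^ 2 + ε ^ 2)) f' := by
  have hpos : ∀ x, 0 < g x ^ 2 + ε ^ 2 := fun x => by positivity
  set h : ℝ → ℝ := fun x => √(g x ^ 2 + ε ^ 2) - ε with hh
  have hC : ContDiff ℝ 2 h :=
    (((hg.pow 2).add contDiff_const).sqrt fun x => (hpos x).ne').sub contDiff_const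
  have hS : HasCompactSupport h := by
    refine hs.mono' fun x hx => subset_tsupport _ ?_
    intro h0
    apply hx
    simp [hh, h0, Real.sqrt_sq hε.le]
  have hC1 : ContDiff ℝ 1 (deriv h) := ((contDiff_succ_iff_deriv (n := 1)).1 hC).2.2
  have hC2 : Continuous (deriv (deriv h)) := ((contDiff_succ_iff_deriv (n := 0)).1 hC1).2.2.continuous
  obtain ⟨M, hM⟩ := hS.exists_bound_of_continuous hC.continuous
  obtain ⟨L₁, hL₁⟩ := hS.deriv.exists_bound_of_continuous hC1.continuous
  obtain ⟨L₂, hL₂⟩ := hS.deriv.deriv.exists_bound_of_continuous hC2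
  have hL₂0 : 0 ≤ L₂ := (norm_nonneg _).trans (hL₂ 0)
  have hd1 : ∀ x, HasDerivAt h (deriv h x) x := fun x =>
    (hC.differentiable (by norm_num) x).hasDerivAt
  have hd2 : ∀ x, HasDerivAt (deriv h) (deriv (deriv h) x) x := fun x =>
    (hC1.differentiable (by norm_num) x).hasDerivAt
  have hlip : ∀ x s, ‖deriv h (x + s) - deriv h x‖ ≤ L₂ * ‖s‖ := by
    intro x s
    have := Convex.norm_image_sub_le_of_norm_hasDerivWithin_le (f := deriv h) (s := Set.univ)
      (C := L₂) (fun y _ => (hd2 y).hasDerivWithinAt) (fun y _ => hL₂ y) convex_univ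
      (Set.mem_univ x) (Set.mem_univ (x + s))
    simpa using this
  have htay : ∀ x y, |h (x + y) - h x - deriv h x * y| ≤ L₂ * y ^ 2 := by
    intro x y
    have hd3 : ∀ s, HasDerivAt (fun s => h (x + s) - deriv h x * s)
        (deriv h (x + s) - deriv h x) s := by
      intro s
      have h1 : HasDerivAt (fun s => h (x + s)) (deriv h (x + s)) s :=
        HasDerivAt.comp_const_add x s (hd1 (x + s))
      exact (h1.sub ((hasDerivAt_id s).const_mul (deriv h x))).congr_deriv (by simp)
    have := Convex.norm_image_sub_le_of_norm_hasDerivWithin_le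
      (f := fun s => h (x + s) - deriv h x * s) (s := Set.uIcc 0 y)
      (C := L₂ * |y|) (fun s _ => (hd3 s).hasDerivWithinAt)
      (fun s hs => (hlip x s).trans (mul_le_mul_of_nonneg_left (by
        have := Set.abs_sub_left_of_mem_uIcc hs
        simpa using this) hL₂0)) (convex_uIcc 0 y) Set.left_mem_uIcc Set.right_mem_uIcc
    simp only [add_zero, mul_zero, sub_zero, Real.norm_eq_abs] at this
    calc |h (x + y) - h x - deriv h x * y| = |h (x + y) - deriv h x * y - h x| := by ring_nf
      _ ≤ L₂ * |y| * |y| := this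
      _ = L₂ * y ^ 2 := by rw [mul_assoc, abs_mul_abs_self]; ring
  refine ⟨M + ε, max L₁ L₂, deriv h, ?_, hC1.continuous, fun x => ?_, fun x => ?_, fun x => ?_,
    fun x y => ?_⟩
  · have : Continuous g := hg.continuous
    fun_prop
  · exact Real.le_sqrt_of_sq_le (by nlinarith [sq_nonneg (g x)])
  · have := (le_abs_self _).trans (hM x)
    simp only [hh] at this
    linarith
  · exact (hL₁ x).trans (le_max_left _ _)
  · have := htay x y
    simp only [hh, sub_sub_sub_cancel_right] at this
    refine this.trans ?_
    gcongr
    exact le_max_right _ _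

theorem abs_sqrt_sq_add_sq_sub_le {s t ε : ℝ} (ht : 0 ≤ t) (hε : 0 ≤ ε) :
    |√(s ^ 2 + ε ^ 2) - t| ≤ |t - s| + ε := by
  have h1 : √(s ^ 2 + ε ^ 2) ≤ |s| + ε := by
    rw [Real.sqrt_le_left (by positivity)]
    nlinarith [sq_abs s, mul_nonneg (abs_nonneg s) hε]
  have h2 : |s| ≤ √(s ^ 2 + ε ^ 2) := Real.abs_le_sqrt (by nlinarith [sq_nonneg ε])
  have h3 : |s| - t ≤ |t - s| := by
    have := abs_sub_abs_le_abs_sub s t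
    rwa [abs_of_nonneg ht, abs_sub_comm] at this
  have h4 : t - |s| ≤ |t - s| := by
    have := abs_sub_abs_le_abs_sub t s
    rwa [abs_of_nonneg ht] at this
  rw [abs_le]
  constructor <;> linarith

/-- Nonnegative integrable functions are limits, in mean and almost everywhere, of pinched ones. -/
theorem exists_seq_isPinched {μ : Measure ℝ} [IsProbabilityMeasure μ] {F : ℝ → ℝ}
    (hF : Integrable F μ) (h0 : ∀ x, 0 ≤ F x) :
    ∃ G : ℕ → ℝ → ℝ, (∀ n, ∃ ε M L G', 0 < ε ∧ IsPinched ε M L (G n) G') ∧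
      Tendsto (fun n => ∫ x, G n x ∂μ) atTop (𝓝 (∫ x, F x ∂μ)) ∧
      ∀ᵐ x ∂μ, Tendsto (fun n => G n x) atTop (𝓝 (F x)) := by
  have hex : ∀ n : ℕ, ∃ g : ℝ → ℝ, (∃ ε M L g', 0 < ε ∧ IsPinched ε M L g g') ∧
      ∫ x, |g x - F x| ∂μ ≤ 1 / (n + 1 : ℝ) := by
    intro n
    -- Half of the tolerance pays for the smooth approximation g, half for regularising |g|.
    have hε : (0 : ℝ) < 1 / (n + 1) / 2 := by positivity
    obtain ⟨g, hg1, hg2, hg3⟩ := (memLp_one_iff_integrable.2 hF).exist_eLpNorm_sub_le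
      (by simp) le_rfl hε
    obtain ⟨M, L, f', hf'⟩ := exists_isPinched_sqrt (contDiff_infty.1 hg2 2) hg1 hε
    refine ⟨_, ⟨_, M, L, f', hε, hf'⟩, ?_⟩
    have hgi : Integrable g μ := hg2.continuous.integrable_of_hasCompactSupport hg1
    have hb : ∫ x, |F x - g x| ∂μ ≤ 1 / (n + 1) / 2 := by
      rw [eLpNorm_one_eq_lintegral_enorm] at hg3
      have := integral_norm_eq_lintegral_enorm (hF.sub hgi).aestronglyMeasurable
      simp only [Pi.sub_apply, Real.norm_eq_abs] at this hg3
      rw [this]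
      exact ENNReal.toReal_le_of_le_ofReal hε.le hg3
    calc ∫ x, |√(g x ^ 2 + (1 / (n + 1) / 2) ^ 2) - F x| ∂μ
        ≤ ∫ x, (|F x - g x| + 1 / (n + 1) / 2) ∂μ := by
          refine integral_mono_of_nonneg (Eventually.of_forall fun x => abs_nonneg _)
            ((hF.sub hgi).abs.add (integrable_const _))
            (Eventually.of_forall fun x => abs_sqrt_sq_add_sq_sub_le (h0 x) hε.le)
      _ = (∫ x, |F x - g x| ∂μ) + 1 / (n + 1) / 2 := by
          have hi : Integrable (fun x => |F x - g x|) μ := (hF.sub hgi).abs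
          rw [integral_add hi (integrable_const _)]
          simp
      _ ≤ 1 / (n + 1) := by linarith
  choose G hG1 hG2 using hex
  have hGi : ∀ n, Integrable (G n) μ := by
    intro n
    obtain ⟨ε, M, L, G', hε, hp⟩ := hG1 n
    exact integrable_of_continuous_bounded hp.cont (hp.abs_apply_le hε)
  have hz : Tendsto (fun n : ℕ => (1 : ℝ) / (n + 1)) atTop (𝓝 0) := tendsto_one_div_add_atTop_nhds_zero_nat
  have hLp : Tendsto (fun n => eLpNorm (G n - F) 1 μ) atTop (𝓝 0) := by
    have h1 : ∀ n, eLpNorm (G n - F) 1 μ ≤ ENNReal.ofReal (1 / (n + 1 : ℝ)) := by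
      intro n
      rw [eLpNorm_one_eq_lintegral_enorm, ← ofReal_integral_norm_eq_lintegral_enorm ((hGi n).sub hF)]
      exact ENNReal.ofReal_le_ofReal (hG2 n)
    have h2 : Tendsto (fun n : ℕ => ENNReal.ofReal (1 / (n + 1 : ℝ))) atTop (𝓝 0) := by
      simpa using ENNReal.tendsto_ofReal hz
    exact tendsto_of_tendsto_of_tendsto_of_le_of_le tendsto_const_nhds h2 (fun _ => zero_le) h1
  -- Convergence in mean gives convergence in measure, hence almost everywhere along a subsequence.
  obtain ⟨ns, hns, hae⟩ := (tendstoInMeasure_of_tendsto_eLpNorm one_ne_zero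
    (fun n => (hGi n).aestronglyMeasurable) hF.aestronglyMeasurable hLp).exists_seq_tendsto_ae
  refine ⟨fun n => G (ns n), fun n => hG1 _, ?_, hae⟩
  have hinteg : Tendsto (fun n => ∫ x, G n x ∂μ) atTop (𝓝 (∫ x, F x ∂μ)) := by
    rw [tendsto_iff_norm_sub_tendsto_zero]
    refine squeeze_zero (fun _ => norm_nonneg _) (fun n => ?_) hz
    rw [← integral_sub (hGi n) hF]
    exact (norm_integral_le_integral_norm _).trans (hG2 n)
  exact hinteg.comp hns.tendsto_atTop

/-- The two-function hypercontractive inequality for nonnegative integrable functions. -/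
theorem IsStablePair.lintegral_rpow_mul_le {ν : Measure (ℝ × ℝ)} [IsProbabilityMeasure ν]
    {A B D a b : ℝ} (hν : IsStablePair ν A B D) (ha : 0 < a) (ha1 : a < 1) (hb : 0 < b) (hb1 : b < 1)
    (hAB : a * b * B ^ 2 ≤ (1 - a) * (1 - b) * (A * D)) {F H : ℝ → ℝ} (hF0 : ∀ x, 0 ≤ F x)
    (hH0 : ∀ x, 0 ≤ H x) (hF : Integrable F (ν.map Prod.fst)) (hH : Integrable H (ν.map Prod.snd)) :
    ∫⁻ z, ENNReal.ofReal (F z.1 ^ a * H z.2 ^ b) ∂ν ≤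
      ENNReal.ofReal ((∫ x, F x ∂ν.map Prod.fst) ^ a * (∫ y, H y ∂ν.map Prod.snd) ^ b) := by
  have : IsProbabilityMeasure (ν.map Prod.fst) :=
    Measure.isProbabilityMeasure_map measurable_fst.aemeasurable
  have : IsProbabilityMeasure (ν.map Prod.snd) :=
    Measure.isProbabilityMeasure_map measurable_snd.aemeasurable
  obtain ⟨f, hf1, hf2, hf3⟩ := exists_seq_isPinched hF hF0
  obtain ⟨h, hh1, hh2, hh3⟩ := exists_seq_isPinched hH hH0
  have hfc : ∀ n, Continuous (f n) := fun n => by obtain ⟨_, _, _, _, _, hp⟩ := hf1 n; exact hp.cont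
  have hhc : ∀ n, Continuous (h n) := fun n => by obtain ⟨_, _, _, _, _, hp⟩ := hh1 n; exact hp.cont
  have hstep : ∀ n, ∫⁻ z, ENNReal.ofReal (f n z.1 ^ a * h n z.2 ^ b) ∂ν ≤
      ENNReal.ofReal ((∫ x, f n x ∂ν.map Prod.fst) ^ a * (∫ y, h n y ∂ν.map Prod.snd) ^ b) := by
    intro n
    obtain ⟨ε₁, M₁, L₁, f', hε₁, hp₁⟩ := hf1 n
    obtain ⟨ε₂, M₂, L₂, h', hε₂, hp₂⟩ := hh1 n
    have q1 := hp₁.mono (min_le_left ε₁ ε₂) (le_max_left M₁ M₂) (le_max_left L₁ L₂)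
    have q2 := hp₂.mono (min_le_right ε₁ ε₂) (le_max_right M₁ M₂) (le_max_right L₁ L₂)
    have hε : 0 < min ε₁ ε₂ := lt_min hε₁ hε₂
    have key := hν.integral_rpow_mul_le ha ha1 hb hb1 hAB hε q1 q2
    rw [integral_map measurable_fst.aemeasurable (hfc n).aestronglyMeasurable,
      integral_map measurable_snd.aemeasurable (hhc n).aestronglyMeasurable]
    have hc : Continuous fun z : ℝ × ℝ => f n z.1 ^ a * h n z.2 ^ b :=
      (((hfc n).comp continuous_fst).rpow_const fun _ => Or.inr ha.le).mul
        (((hhc n).comp continuous_snd).rpow_const fun _ => Or.inr hb.le)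
    have h0 : ∀ z : ℝ × ℝ, 0 ≤ f n z.1 ^ a * h n z.2 ^ b := fun z =>
      mul_nonneg (Real.rpow_nonneg (hε.le.trans (q1.lower _)) _)
        (Real.rpow_nonneg (hε.le.trans (q2.lower _)) _)
    rw [← ofReal_integral_eq_lintegral_ofReal ?_ (Eventually.of_forall h0)]
    · exact ENNReal.ofReal_le_ofReal key
    · refine integrable_of_continuous_bounded hc (M := max M₁ M₂ ^ a * max M₁ M₂ ^ b) fun z => ?_
      rw [abs_of_nonneg (h0 z)]
      have hM : 0 ≤ max M₁ M₂ := hε.le.trans ((q1.lower 0).trans (q1.upper 0))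
      exact mul_le_mul (Real.rpow_le_rpow (hε.le.trans (q1.lower _)) (q1.upper _) ha.le)
        (Real.rpow_le_rpow (hε.le.trans (q2.lower _)) (q2.upper _) hb.le)
        (Real.rpow_nonneg (hε.le.trans (q2.lower _)) _) (by positivity)
  have hae : ∀ᵐ z ∂ν, Tendsto (fun n => ENNReal.ofReal (f n z.1 ^ a * h n z.2 ^ b)) atTop
      (𝓝 (ENNReal.ofReal (F z.1 ^ a * H z.2 ^ b))) := by
    filter_upwards [ae_of_ae_map measurable_fst.aemeasurable hf3,
      ae_of_ae_map measurable_snd.aemeasurable hh3] with z h1 h2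
    exact ENNReal.tendsto_ofReal ((h1.rpow_const (Or.inr ha.le)).mul (h2.rpow_const (Or.inr hb.le)))
  have hlim := ENNReal.tendsto_ofReal
    ((hf2.rpow_const (Or.inr ha.le)).mul (hh2.rpow_const (Or.inr hb.le)))
  -- Fatou on the left; on the right only the convergence of the two means is needed.
  calc ∫⁻ z, ENNReal.ofReal (F z.1 ^ a * H z.2 ^ b) ∂ν
      = ∫⁻ z, liminf (fun n => ENNReal.ofReal (f n z.1 ^ a * h n z.2 ^ b)) atTop ∂ν :=
        lintegral_congr_ae (hae.mono fun z hz => hz.liminf_eq.symm)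
    _ ≤ liminf (fun n => ∫⁻ z, ENNReal.ofReal (f n z.1 ^ a * h n z.2 ^ b) ∂ν) atTop := by
        refine lintegral_liminf_le fun n => ?_
        have := (hfc n).measurable
        have := (hhc n).measurable
        fun_prop
    _ ≤ liminf (fun n => ENNReal.ofReal ((∫ x, f n x ∂ν.map Prod.fst) ^ a *
          (∫ y, h n y ∂ν.map Prod.snd) ^ b)) atTop := liminf_le_liminf (Eventually.of_forall hstep)
    _ = _ := hlim.liminf_eq

/-! ### The sharp constant and the bilinear heat kernel estimate -/

/-- The sharp constant as a function of `P = 1/p` and `R = 1/r`. -/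
noncomputable def sharpConst (P R : ℝ) : ℝ :=
  √(P ^ (-P) * (1 - P) ^ (1 - P) * (P - R) ^ (P - R) * R ^ R * (1 - R) ^ (-(1 - R))) *
    (4 * Real.pi) ^ (-(P - R) / 2)

namespace ProbabilityTheory

open scoped NNReal

theorem map_fst_gaussianPair (v w : ℝ≥0) (c : ℝ) :
    (gaussianPair v w c).map Prod.fst = gaussianReal 0 v := by
  rw [gaussianPair, Measure.map_map measurable_fst (by fun_prop)]
  exact Measure.fst_prod

theorem map_snd_gaussianPair {v w V : ℝ≥0} {c : ℝ} (hV : (V : ℝ) = c ^ 2 * v + w) :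
    (gaussianPair v w c).map Prod.snd = gaussianReal 0 V := by
  rw [gaussianPair, Measure.map_map measurable_snd (by fun_prop)]
  have h1 : (gaussianReal 0 v).map (c * ·) ∗ gaussianReal 0 w = gaussianReal 0 V := by
    rw [gaussianReal_map_const_mul, gaussianReal_conv_gaussianReal, mul_zero, add_zero]
    congr 1
    ext
    simp [hV]
  rw [← h1, Measure.conv]
  conv_rhs => rw [← Measure.map_id (μ := gaussianReal 0 w)]
  rw [Measure.map_prod_map _ _ (by fun_prop) (by fun_prop), Measure.map_map (by fun_prop) (by fun_prop)]
  rfl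

theorem lintegral_gaussianReal {v : ℝ≥0} (hv : v ≠ 0) {φ : ℝ → ℝ≥0∞} (hφ : Measurable φ) :
    ∫⁻ x, φ x ∂gaussianReal 0 v = ∫⁻ x, gaussianPDF 0 v x * φ x := by
  rw [gaussianReal_of_var_ne_zero _ hv,
    lintegral_withDensity_eq_lintegral_mul _ (measurable_gaussianPDF 0 v) hφ]
  rfl

theorem lintegral_gaussianPair {v w : ℝ≥0} (hv : v ≠ 0) (hw : w ≠ 0) (c : ℝ) {φ : ℝ × ℝ → ℝ≥0∞}
    (hφ : Measurable φ) : ∫⁻ z, φ z ∂gaussianPair v w c =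
      ∫⁻ x, ∫⁻ y, gaussianPDF 0 v x * gaussianPDF 0 w (y - c * x) * φ (x, y) := by
  have hm := measurable_gaussianPDF 0 w
  rw [gaussianPair, lintegral_map hφ (by fun_prop), lintegral_prod _ (by fun_prop),
    lintegral_gaussianReal hv (by fun_prop)]
  refine lintegral_congr fun x => ?_
  rw [lintegral_gaussianReal hw (by fun_prop), ← lintegral_const_mul _ (by fun_prop),
    ← lintegral_sub_right_eq_self _ (c * x)]
  refine lintegral_congr fun y => ?_
  simp [mul_assoc]

theorem integrable_div_gaussianPDFReal {v : ℝ≥0} (hv : v ≠ 0) {F : ℝ → ℝ} (hF : Integrable F) :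
    Integrable (fun x => F x / gaussianPDFReal 0 v x) (gaussianReal 0 v) := by
  rw [gaussianReal_of_var_ne_zero _ hv, integrable_withDensity_iff (measurable_gaussianPDF 0 v)
    (Eventually.of_forall fun x => gaussianPDF_lt_top)]
  refine hF.congr (Eventually.of_forall fun x => ?_)
  simp only [toReal_gaussianPDF]
  rw [div_mul_cancel₀ _ (gaussianPDFReal_pos 0 v x hv).ne']

theorem integral_div_gaussianPDFReal {v : ℝ≥0} (hv : v ≠ 0) (F : ℝ → ℝ) :
    ∫ x, F x / gaussianPDFReal 0 v x ∂gaussianReal 0 v = ∫ x, F x := by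
  rw [integral_gaussianReal_eq_integral_smul hv]
  refine integral_congr_ae (Eventually.of_forall fun x => ?_)
  simp only [smul_eq_mul]
  rw [mul_div_cancel₀ _ (gaussianPDFReal_pos 0 v x hv).ne']

theorem gaussianPDFReal_eq_exp {v : ℝ≥0} (hv : v ≠ 0) (x : ℝ) :
    gaussianPDFReal 0 v x = Real.exp (-(Real.log (2 * Real.pi * v) / 2) - x ^ 2 / (2 * v)) := by
  have hv0 : (0 : ℝ) < v := by positivity
  have h2 : (0 : ℝ) < 2 * Real.pi * v := by positivity
  rw [gaussianPDFReal, Real.exp_sub, Real.exp_neg, ← Real.log_sqrt h2.le,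
    Real.exp_log (Real.sqrt_pos.2 h2), sub_zero, neg_div, Real.exp_neg]
  field_simp

end ProbabilityTheory

theorem heatKernel_eq_exp {t : ℝ} (ht : 0 < t) (x : ℝ) :
    heatKernel t x = Real.exp (-(Real.log (4 * Real.pi * t) / 2) - x ^ 2 / (4 * t)) := by
  have h2 : (0 : ℝ) < 4 * Real.pi * t := by positivity
  have h3 : 2 * √(Real.pi * t) = √(4 * Real.pi * t) := by
    rw [mul_assoc, Real.sqrt_mul (by norm_num : (0 : ℝ) ≤ 4)]
    congr 1
    rw [show (4 : ℝ) = 2 ^ 2 by norm_num, Real.sqrt_sq (by norm_num)]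
  rw [heatKernel, Real.exp_sub, Real.exp_neg, ← Real.log_sqrt h2.le,
    Real.exp_log (Real.sqrt_pos.2 h2), neg_div, Real.exp_neg, h3]
  field_simp

/-- The convention 0 ^ 0 = 1 is what lets the formulas in P and R include the boundary exponents. -/
theorem rpow_self_pos {x : ℝ} (hx : 0 ≤ x) : 0 < x ^ x := by
  rcases hx.eq_or_lt with rfl | h
  · simp
  · positivity

theorem sharpConst_eq {P R : ℝ} (hP : 0 ≤ P) (hR1 : R ≤ 1) :
    sharpConst P R = √((P ^ P)⁻¹ * (1 - P) ^ (1 - P) * (P - R) ^ (P - R) * R ^ R *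
      ((1 - R) ^ (1 - R))⁻¹) * (4 * Real.pi) ^ (-(P - R) / 2) := by
  rw [sharpConst, Real.rpow_neg hP, Real.rpow_neg (by linarith : 0 ≤ 1 - R)]

theorem sharpConst_pos {P R : ℝ} (hR : 0 ≤ R) (hRP : R ≤ P) (hP : P ≤ 1) : 0 < sharpConst P R := by
  have h1 := rpow_self_pos (hR.trans hRP)
  have h2 := rpow_self_pos hR
  have h3 := rpow_self_pos (sub_nonneg.2 hRP)
  have h4 := rpow_self_pos (sub_nonneg.2 hP)
  have h5 := rpow_self_pos (sub_nonneg.2 (hRP.trans hP))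
  rw [sharpConst_eq (hR.trans hRP) (hRP.trans hP)]
  positivity

theorem log_sharpConst {P R : ℝ} (hR : 0 < R) (hRP : R < P) (hP : P < 1) :
    Real.log (sharpConst P R) = (-P * Real.log P + (1 - P) * Real.log (1 - P)
      + (P - R) * Real.log (P - R) + R * Real.log R - (1 - R) * Real.log (1 - R)) / 2
      - (P - R) / 2 * Real.log (4 * Real.pi) := by
  have : 0 < P := hR.trans hRP
  have : 0 < 1 - P := by linarith
  have : 0 < P - R := by linarith
  have : 0 < 1 - R := by linarith
  unfold sharpConst
  rw [Real.log_mul (by positivity) (by positivity), Real.log_sqrt (by positivity),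
    Real.log_mul (by positivity) (by positivity), Real.log_mul (by positivity) (by positivity),
    Real.log_mul (by positivity) (by positivity), Real.log_mul (by positivity) (by positivity),
    Real.log_rpow (by positivity), Real.log_rpow (by positivity), Real.log_rpow (by positivity),
    Real.log_rpow (by positivity), Real.log_rpow (by positivity), Real.log_rpow (by positivity)]
  ring

open ProbabilityTheory in
/-- Sharp bilinear estimate for the heat kernel. -/
theorem lintegral_rpow_mul_rpow_mul_heatKernel_le {P R t : ℝ} (hR : 0 < R) (hRP : R < P) (hP : P < 1)
    (ht : 0 < t) {F H : ℝ → ℝ} (hFm : Measurable F) (hHm : Measurable H) (hF0 : ∀ x, 0 ≤ F x)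
    (hH0 : ∀ x, 0 ≤ H x) (hF : Integrable F) (hH : Integrable H) :
    ∫⁻ x, ∫⁻ y, ENNReal.ofReal (F x ^ P * H y ^ (1 - R) * heatKernel t (y - x)) ≤
      ENNReal.ofReal (sharpConst P R * t ^ (-(P - R) / 2) *
        ((∫ x, F x) ^ P * (∫ y, H y) ^ (1 - R))) := by
  have hP0 : 0 < P := hR.trans hRP
  have hP1 : 0 < 1 - P := by linarith
  have hQ : 0 < P - R := by linarith
  have hR1 : 0 < 1 - R := by linarith
  -- The values c, v, w and V = c²v + w are those for which (y-x)²/(4t) = (1-P)x²/(2v) +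
  -- (y-cx)²/(2w) - (1-R)y²/(2V) identically, so that the heat kernel is the joint density over
  -- powers of the marginal densities, up to a constant.
  set c := R / P with hc
  obtain ⟨v, hv⟩ : ∃ v : NNReal, (v : ℝ) = 2 * t * ((1 - P) * P) / (P - R) :=
    ⟨⟨_, by positivity⟩, rfl⟩
  obtain ⟨w, hw⟩ : ∃ w : NNReal, (w : ℝ) = 2 * t * R / P := ⟨⟨_, by positivity⟩, rfl⟩
  obtain ⟨V, hV⟩ : ∃ V : NNReal, (V : ℝ) = 2 * t * ((1 - R) * R) / (P - R) :=
    ⟨⟨_, by positivity⟩, rfl⟩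
  have hv0 : (0 : ℝ) < v := by rw [hv]; positivity
  have hw0 : (0 : ℝ) < w := by rw [hw]; positivity
  have hV0 : (0 : ℝ) < V := by rw [hV]; positivity
  have hvn : v ≠ 0 := by exact_mod_cast hv0.ne'
  have hwn : w ≠ 0 := by exact_mod_cast hw0.ne'
  have hVn : V ≠ 0 := by exact_mod_cast hV0.ne'
  have hVvw : (V : ℝ) = c ^ 2 * v + w := by
    rw [hV, hv, hw, hc]; field_simp; ring
  have hst := isStablePair_gaussianPair v w c
  rw [← hVvw] at hst
  -- With these variances the covariance condition is an equality.
  have hAB : P * (1 - R) * (c * v) ^ 2 ≤ (1 - P) * (1 - (1 - R)) * (v * V) := by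
    apply le_of_eq
    rw [hV, hv, hc]; field_simp; ring
  have key := hst.lintegral_rpow_mul_le (F := fun x => F x / gaussianPDFReal 0 v x)
    (H := fun y => H y / gaussianPDFReal 0 V y) hP0 hP hR1 (by linarith) hAB
    (fun x => div_nonneg (hF0 x) (gaussianPDFReal_nonneg _ _ _))
    (fun x => div_nonneg (hH0 x) (gaussianPDFReal_nonneg _ _ _))
    (by rw [map_fst_gaussianPair]; exact integrable_div_gaussianPDFReal hvn hF)
    (by rw [map_snd_gaussianPair hVvw]; exact integrable_div_gaussianPDFReal hVn hH)
  rw [map_fst_gaussianPair, map_snd_gaussianPair hVvw, integral_div_gaussianPDFReal hvn,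
    integral_div_gaussianPDFReal hVn] at key
  have m1 := measurable_gaussianPDFReal 0 v
  have m2 := measurable_gaussianPDFReal 0 V
  rw [lintegral_gaussianPair hvn hwn c (by fun_prop)] at key
  set κ := sharpConst P R * t ^ (-(P - R) / 2) with hκ
  have hκ0 : 0 < κ := mul_pos (sharpConst_pos hR.le hRP.le hP.le) (Real.rpow_pos_of_pos ht _)
  have hκe : κ = Real.exp (Real.log (sharpConst P R) + Real.log t * (-(P - R) / 2)) := by
    rw [Real.exp_add, Real.exp_log (sharpConst_pos hR.le hRP.le hP.le), ← Real.rpow_def_of_pos ht, hκ]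
  have hpt : ∀ x y, ENNReal.ofReal (F x ^ P * H y ^ (1 - R) * heatKernel t (y - x)) =
      ENNReal.ofReal κ * (gaussianPDF 0 v x * gaussianPDF 0 w (y - c * x) *
        ENNReal.ofReal ((F x / gaussianPDFReal 0 v x) ^ P *
          (H y / gaussianPDFReal 0 V y) ^ (1 - R))) := by
    intro x y
    rw [gaussianPDF, gaussianPDF, ← ENNReal.ofReal_mul (gaussianPDFReal_nonneg _ _ _),
      ← ENNReal.ofReal_mul (mul_nonneg (gaussianPDFReal_nonneg _ _ _) (gaussianPDFReal_nonneg _ _ _)),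
      ← ENNReal.ofReal_mul hκ0.le,
      Real.div_rpow (hF0 x) (gaussianPDFReal_nonneg _ _ _),
      Real.div_rpow (hH0 y) (gaussianPDFReal_nonneg _ _ _)]
    congr 1
    -- Both sides are exponentials. The quadratic parts agree by the choice of parameters, and
    -- comparing the constant parts identifies `sharpConst`.
    have e1 : heatKernel t (y - x) = κ * (gaussianPDFReal 0 v x * gaussianPDFReal 0 w (y - c * x) *
        ((gaussianPDFReal 0 v x ^ P)⁻¹ * (gaussianPDFReal 0 V y ^ (1 - R))⁻¹)) := by
      rw [heatKernel_eq_exp ht, gaussianPDFReal_eq_exp hvn, gaussianPDFReal_eq_exp hwn,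
        gaussianPDFReal_eq_exp hVn, ← Real.exp_mul, ← Real.exp_mul, ← Real.exp_neg, ← Real.exp_neg,
        ← Real.exp_add, ← Real.exp_add, ← Real.exp_add, hκe, ← Real.exp_add]
      congr 1
      have l0 : Real.log (4 * Real.pi * t) = Real.log (4 * Real.pi) + Real.log t :=
        Real.log_mul (by positivity) ht.ne'
      have l1 : Real.log (2 * Real.pi * v) = Real.log (4 * Real.pi) + Real.log t
          + Real.log (1 - P) + Real.log P - Real.log (P - R) := by
        rw [hv, show 2 * Real.pi * (2 * t * ((1 - P) * P) / (P - R))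
          = 4 * Real.pi * t * (1 - P) * P / (P - R) by ring, Real.log_div (by positivity) (by positivity),
          Real.log_mul (by positivity) (by positivity), Real.log_mul (by positivity) (by positivity), l0]
      have l2 : Real.log (2 * Real.pi * w) = Real.log (4 * Real.pi) + Real.log t
          + Real.log R - Real.log P := by
        rw [hw, show 2 * Real.pi * (2 * t * R / P) = 4 * Real.pi * t * R / P by ring,
          Real.log_div (by positivity) (by positivity), Real.log_mul (by positivity) (by positivity), l0]
      have l3 : Real.log (2 * Real.pi * V) = Real.log (4 * Real.pi) + Real.log t
          + Real.log (1 - R) + Real.log R - Real.log (P - R) := by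
        rw [hV, show 2 * Real.pi * (2 * t * ((1 - R) * R) / (P - R))
          = 4 * Real.pi * t * (1 - R) * R / (P - R) by ring, Real.log_div (by positivity) (by positivity),
          Real.log_mul (by positivity) (by positivity), Real.log_mul (by positivity) (by positivity), l0]
      rw [l0, l1, l2, l3, log_sharpConst hR hRP hP]
      have q : (y - x) ^ 2 / (4 * t) = (1 - P) * (x ^ 2 / (2 * v)) + (y - c * x) ^ 2 / (2 * w)
          - (1 - R) * (y ^ 2 / (2 * V)) := by
        rw [hv, hw, hV, hc]
        field_simp
        ring
      rw [q]
      ring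
    rw [e1]
    ring
  simp only [hpt]
  have hmeas : Measurable (Function.uncurry fun x y : ℝ => gaussianPDF 0 v x *
      gaussianPDF 0 w (y - c * x) * ENNReal.ofReal ((F x / gaussianPDFReal 0 v x) ^ P *
          (H y / gaussianPDFReal 0 V y) ^ (1 - R))) := by
    have := measurable_gaussianPDF 0 v
    have := measurable_gaussianPDF 0 w
    unfold Function.uncurry
    fun_prop
  rw [ENNReal.ofReal_mul hκ0.le]
  calc _ = ∫⁻ x, ENNReal.ofReal κ * ∫⁻ y, gaussianPDF 0 v x *
      gaussianPDF 0 w (y - c * x) * ENNReal.ofReal ((F x / gaussianPDFReal 0 v x) ^ P *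
          (H y / gaussianPDFReal 0 V y) ^ (1 - R)) :=
        lintegral_congr fun x => lintegral_const_mul _ (hmeas.of_uncurry_left)
    _ = ENNReal.ofReal κ * ∫⁻ x, ∫⁻ y, gaussianPDF 0 v x *
      gaussianPDF 0 w (y - c * x) * ENNReal.ofReal ((F x / gaussianPDFReal 0 v x) ^ P *
          (H y / gaussianPDFReal 0 V y) ^ (1 - R)) :=
        lintegral_const_mul _ (hmeas.lintegral_prod_right')
    _ ≤ _ := by gcongr

/-! ### Classical convolution bounds and part (a) -/

/-- The Jensen inequality for a weight `f` that need not have total mass one. -/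
theorem lintegral_mul_rpow_le {X : Type*} [MeasurableSpace X] {μ : Measure X} {f g : X → ℝ≥0∞}
    (hf : AEMeasurable f μ) (hg : AEMeasurable g μ) {s : ℝ} (hs : 1 ≤ s) :
    (∫⁻ y, f y * g y ∂μ) ^ s ≤ (∫⁻ y, f y ∂μ) ^ (s - 1) * ∫⁻ y, f y * g y ^ s ∂μ := by
  have hs0 : 0 < s := by linarith
  have h1 : 0 ≤ 1 - s⁻¹ := by
    have := inv_le_one_of_one_le₀ hs
    linarith
  have h2 : 0 ≤ s⁻¹ := by positivity
  -- Hölder for the splitting f g = f^{1-1/s} (f g^s)^{1/s}.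
  have key := ENNReal.lintegral_mul_norm_pow_le (μ := μ) (f := f) (g := fun y => f y * g y ^ s)
    hf (hf.mul (hg.pow_const s)) h1 h2 (by ring)
  have e1 : ∀ y, f y ^ (1 - s⁻¹) * (f y * g y ^ s) ^ s⁻¹ = f y * g y := by
    intro y
    rw [ENNReal.mul_rpow_of_nonneg _ _ h2, ← ENNReal.rpow_mul, mul_inv_cancel₀ hs0.ne',
      ENNReal.rpow_one, ← mul_assoc, ← ENNReal.rpow_add_of_nonneg _ _ h1 h2]
    simp
  simp only [e1] at key
  calc (∫⁻ y, f y * g y ∂μ) ^ s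
      ≤ ((∫⁻ y, f y ∂μ) ^ (1 - s⁻¹) * (∫⁻ y, f y * g y ^ s ∂μ) ^ s⁻¹) ^ s := by gcongr
    _ = _ := by
      rw [ENNReal.mul_rpow_of_nonneg _ _ hs0.le, ← ENNReal.rpow_mul, ← ENNReal.rpow_mul,
        inv_mul_cancel₀ hs0.ne', ENNReal.rpow_one, sub_mul, one_mul, inv_mul_cancel₀ hs0.ne']

/-- The Young convolution inequality with one factor in `L¹`. -/
theorem lintegral_lconvolution_rpow_le {f g : ℝ → ℝ≥0∞} (hf : Measurable f) (hg : Measurable g)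
    {s : ℝ} (hs : 1 ≤ s) :
    ∫⁻ x, (∫⁻ y, f y * g (x - y)) ^ s ≤ (∫⁻ y, f y) ^ s * ∫⁻ y, g y ^ s := by
  calc ∫⁻ x, (∫⁻ y, f y * g (x - y)) ^ s
      ≤ ∫⁻ x, (∫⁻ y, f y) ^ (s - 1) * ∫⁻ y, f y * g (x - y) ^ s := by
        refine lintegral_mono fun x => lintegral_mul_rpow_le hf.aemeasurable ?_ hs
        fun_prop
    _ = (∫⁻ y, f y) ^ (s - 1) * ∫⁻ x, ∫⁻ y, f y * g (x - y) ^ s :=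
        lintegral_const_mul _ (Measurable.lintegral_prod_right (by fun_prop))
    _ = (∫⁻ y, f y) ^ (s - 1) * ∫⁻ y, ∫⁻ x, f y * g (x - y) ^ s := by
        rw [lintegral_lintegral_swap]
        fun_prop
    _ = (∫⁻ y, f y) ^ (s - 1) * ∫⁻ y, f y * ∫⁻ x, g x ^ s := by
        congr 1
        refine lintegral_congr fun y => ?_
        rw [lintegral_const_mul _ (by fun_prop), lintegral_sub_right_eq_self (fun x => g x ^ s) y]
    _ = (∫⁻ y, f y) ^ (s - 1) * (∫⁻ y, f y) ^ (1 : ℝ) * ∫⁻ x, g x ^ s := by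
        rw [lintegral_mul_const _ hf, ENNReal.rpow_one, mul_assoc]
    _ = _ := by
        rw [← ENNReal.rpow_add_of_nonneg _ _ (by linarith) zero_le_one, sub_add_cancel]

/-- Working with 1/p makes one formula cover p = ∞: there `p.toReal⁻¹` is 0 and the right side is 0
^ 0 = 1. -/
theorem eLpNorm_gaussian {k : ℝ} (hk : 0 < k) {p : ℝ≥0∞} (hp : 1 ≤ p) :
    eLpNorm (fun x : ℝ => Real.exp (-k * x ^ 2)) p volume =
      ENNReal.ofReal ((Real.pi * p.toReal⁻¹ / k) ^ (p.toReal⁻¹ / 2)) := by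
  have hp0 : p ≠ 0 := (zero_lt_one.trans_le hp).ne'
  by_cases hpt : p = ∞
  · subst hpt
    simp only [eLpNorm_exponent_top, eLpNormEssSup, ENNReal.toReal_top, inv_zero, zero_div,
      Real.rpow_zero, ENNReal.ofReal_one]
    rw [← iSup_eq_essSup]
    · apply le_antisymm
      · refine iSup_le fun x => ?_
        rw [Real.enorm_of_nonneg (Real.exp_nonneg _)]
        exact ENNReal.ofReal_le_one.2 (Real.exp_le_one_iff.2 (by nlinarith [sq_nonneg x]))
      · refine le_iSup_of_le 0 ?_
        simp
    · intro x a hxa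
      refine ne_of_gt (IsOpen.measure_pos volume ?_ ⟨x, hxa⟩)
      exact isOpen_lt continuous_const (by fun_prop)
  · have hpr : 0 < p.toReal := ENNReal.toReal_pos hp0 hpt
    rw [eLpNorm_eq_lintegral_rpow_enorm_toReal hp0 hpt]
    have e1 : ∀ x : ℝ, ‖Real.exp (-k * x ^ 2)‖ₑ ^ p.toReal
        = ENNReal.ofReal (Real.exp (-(p.toReal * k) * x ^ 2)) := by
      intro x
      rw [Real.enorm_of_nonneg (Real.exp_nonneg _), ENNReal.ofReal_rpow_of_nonneg (Real.exp_nonneg _)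
        hpr.le, ← Real.exp_mul]
      congr 2; ring
    simp only [e1]
    rw [← ofReal_integral_eq_lintegral_ofReal (integrable_exp_neg_mul_sq (by positivity))
      (Eventually.of_forall fun x => Real.exp_nonneg _), integral_gaussian,
      ENNReal.ofReal_rpow_of_nonneg (Real.sqrt_nonneg _) (by positivity), Real.sqrt_eq_rpow,
      ← Real.rpow_mul (by positivity)]
    congr 2
    · field_simp
    · ring

theorem heatKernel_pos {t : ℝ} (ht : 0 < t) (x : ℝ) : 0 < heatKernel t x := by
  rw [heatKernel_eq_exp ht]; exact Real.exp_pos _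

theorem continuous_heatKernel (t : ℝ) : Continuous (heatKernel t) := by
  unfold heatKernel; fun_prop

theorem eLpNorm_heatKernel {t : ℝ} (ht : 0 < t) {q : ℝ≥0∞} (hq : 1 ≤ q) :
    eLpNorm (heatKernel t) q volume = ENNReal.ofReal (q.toReal⁻¹ ^ (q.toReal⁻¹ / 2) *
      (4 * Real.pi) ^ (-(1 - q.toReal⁻¹) / 2) * t ^ (-(1 - q.toReal⁻¹) / 2)) := by
  have h1 : heatKernel t = ((4 * Real.pi * t) ^ (-(1 / 2) : ℝ)) •
      fun x => Real.exp (-(1 / (4 * t)) * x ^ 2) := by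
    funext x
    rw [heatKernel_eq_exp ht, Pi.smul_apply, smul_eq_mul, Real.rpow_def_of_pos (by positivity),
      ← Real.exp_add]
    congr 1
    ring
  set Q := q.toReal⁻¹ with hQ
  have hQ0 : 0 ≤ Q := by positivity
  rw [h1, eLpNorm_const_smul, eLpNorm_gaussian (by positivity) hq, ← hQ,
    Real.enorm_of_nonneg (by positivity), ← ENNReal.ofReal_mul (by positivity)]
  congr 1
  have e1 : Real.pi * Q / (1 / (4 * t)) = Q * (4 * Real.pi * t) := by field_simp
  have e2 : (4 * Real.pi * t) ^ (-(1 / 2) : ℝ) * (4 * Real.pi * t) ^ (Q / 2)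
      = (4 * Real.pi) ^ (-(1 - Q) / 2) * t ^ (-(1 - Q) / 2) := by
    rw [← Real.rpow_add (by positivity), ← Real.mul_rpow (by positivity) ht.le]
    congr 1; ring
  rw [e1, Real.mul_rpow hQ0 (by positivity), mul_left_comm, e2]
  ring

theorem memLp_heatKernel {t : ℝ} (ht : 0 < t) {q : ℝ≥0∞} (hq : 1 ≤ q) :
    MemLp (heatKernel t) q volume :=
  ⟨(continuous_heatKernel t).aestronglyMeasurable, by
    rw [eLpNorm_heatKernel ht hq]; exact ENNReal.ofReal_lt_top⟩

theorem heatConv_apply (f : ℝ → ℝ) (t x : ℝ) :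
    heatConv f t x = ∫ y, f y * heatKernel t (x - y) := rfl

theorem measurePreserving_const_sub (x : ℝ) :
    MeasurePreserving (fun y : ℝ => x - y) volume volume :=
  Measure.measurePreserving_sub_left volume x

theorem convolutionExists_heatKernel {p : ℝ≥0∞} (hp : 1 ≤ p) {f : ℝ → ℝ} (hf : MemLp f p volume)
    {t : ℝ} (ht : 0 < t) :
    ConvolutionExists f (heatKernel t) (ContinuousLinearMap.mul ℝ ℝ) volume := by
  intro x
  have := ENNReal.HolderConjugate.conjExponent hp
  have h1 : MemLp (fun y => heatKernel t (x - y)) p.conjExponent volume :=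
    (memLp_heatKernel ht (ENNReal.HolderConjugate.symm.one_le p.conjExponent p)).comp_measurePreserving
      (measurePreserving_const_sub x)
  exact hf.integrable_mul h1

theorem enorm_heatConv_le (f : ℝ → ℝ) {t : ℝ} (ht : 0 < t) (x : ℝ) :
    ‖heatConv f t x‖ₑ ≤ ∫⁻ y, ‖f y‖ₑ * ENNReal.ofReal (heatKernel t (x - y)) := by
  rw [heatConv_apply]
  refine (enorm_integral_le_lintegral_enorm _).trans_eq (lintegral_congr fun y => ?_)
  rw [enorm_mul, Real.enorm_of_nonneg (heatKernel_pos ht _).le]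

theorem aestronglyMeasurable_heatConv {f : ℝ → ℝ} (hf : AEStronglyMeasurable f volume) (t : ℝ) :
    AEStronglyMeasurable (heatConv f t) volume := by
  have hc := continuous_heatKernel t
  have h1 : AEStronglyMeasurable (fun z : ℝ × ℝ => f z.2 * heatKernel t (z.1 - z.2))
      (volume.prod volume) :=
    hf.comp_snd.mul (by fun_prop : Continuous fun z : ℝ × ℝ => heatKernel t (z.1 - z.2)).aestronglyMeasurable
  exact h1.integral_prod_right'

/-- The heat convolution only depends on the almost everywhere class of `f`. -/
theorem heatConv_congr_ae {f g : ℝ → ℝ} (h : f =ᵐ[volume] g) (t : ℝ) : heatConv f t = heatConv g t :=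
  convolution_congr _ h (ae_eq_refl _)

theorem eLpNorm_heatKernel_const_sub (t x : ℝ) (q : ℝ≥0∞) :
    eLpNorm (fun y => heatKernel t (x - y)) q volume = eLpNorm (heatKernel t) q volume := by
  have hc : AEStronglyMeasurable (heatKernel t) volume :=
    (continuous_heatKernel t).aestronglyMeasurable
  have := eLpNorm_comp_measurePreserving (p := q) hc (measurePreserving_const_sub x)
  exact this

theorem eLpNorm_top_heatConv_le {p q : ℝ≥0∞} [hpq : p.HolderConjugate q] {f : ℝ → ℝ}
    (hf : AEStronglyMeasurable f volume) (t : ℝ) :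
    eLpNorm (heatConv f t) ∞ volume ≤ eLpNorm f p volume * eLpNorm (heatKernel t) q volume := by
  rw [eLpNorm_exponent_top]
  refine eLpNormEssSup_le_of_ae_enorm_bound (Eventually.of_forall fun x => ?_)
  have hm : AEStronglyMeasurable (fun y => heatKernel t (x - y)) volume :=
    ((continuous_heatKernel t).comp (by fun_prop)).aestronglyMeasurable
  have h1 : eLpNorm (f • fun y => heatKernel t (x - y)) 1 volume
      ≤ eLpNorm f p volume * eLpNorm (fun y => heatKernel t (x - y)) q volume :=
    eLpNorm_smul_le_mul_eLpNorm hm hf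
  rw [eLpNorm_heatKernel_const_sub, eLpNorm_one_eq_lintegral_enorm] at h1
  rw [heatConv_apply]
  exact (enorm_integral_le_lintegral_enorm _).trans h1

/-- A bound on the extended-valued convolution of `‖f‖` bounds the heat convolution. -/
theorem eLpNorm_heatConv_le_of_lintegral {f : ℝ → ℝ} {t : ℝ} (ht : 0 < t) {s : ℝ≥0∞} (hs : 1 ≤ s)
    (hst : s ≠ ∞) {C : ℝ≥0∞}
    (h : ∫⁻ x, (∫⁻ y, ‖f y‖ₑ * ENNReal.ofReal (heatKernel t (x - y))) ^ s.toReal ≤ C ^ s.toReal) :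
    eLpNorm (heatConv f t) s volume ≤ C := by
  have hs0 : s ≠ 0 := (zero_lt_one.trans_le hs).ne'
  have hsr : 0 < s.toReal := ENNReal.toReal_pos hs0 hst
  rw [eLpNorm_eq_lintegral_rpow_enorm_toReal hs0 hst, one_div, ENNReal.rpow_inv_le_iff hsr]
  refine (lintegral_mono fun x => ?_).trans h
  exact ENNReal.rpow_le_rpow (enorm_heatConv_le f ht x) hsr.le

theorem eLpNorm_rpow_toReal {f : ℝ → ℝ} {s : ℝ≥0∞} (hs : 1 ≤ s) (hst : s ≠ ∞) :
    eLpNorm f s volume ^ s.toReal = ∫⁻ x, ‖f x‖ₑ ^ s.toReal := by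
  have hs0 : s ≠ 0 := (zero_lt_one.trans_le hs).ne'
  have hsr : 0 < s.toReal := ENNReal.toReal_pos hs0 hst
  rw [eLpNorm_eq_lintegral_rpow_enorm_toReal hs0 hst, ← ENNReal.rpow_mul, one_div,
    inv_mul_cancel₀ hsr.ne', ENNReal.rpow_one]

theorem one_le_toReal {s : ℝ≥0∞} (hs : 1 ≤ s) (hst : s ≠ ∞) : 1 ≤ s.toReal := by
  have := ENNReal.toReal_mono hst hs
  simpa using this

/-- The Young inequality when `f` is integrable. -/
theorem eLpNorm_heatConv_le_of_one {f : ℝ → ℝ} (hf : Measurable f) {t : ℝ} (ht : 0 < t) {s : ℝ≥0∞}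
    (hs : 1 ≤ s) (hst : s ≠ ∞) :
    eLpNorm (heatConv f t) s volume ≤ eLpNorm f 1 volume * eLpNorm (heatKernel t) s volume := by
  refine eLpNorm_heatConv_le_of_lintegral ht hs hst ?_
  have hm := (continuous_heatKernel t).measurable
  rw [ENNReal.mul_rpow_of_nonneg _ _ ENNReal.toReal_nonneg, eLpNorm_rpow_toReal hs hst,
    eLpNorm_one_eq_lintegral_enorm]
  refine (lintegral_lconvolution_rpow_le (g := fun y => ENNReal.ofReal (heatKernel t y)) hf.enorm
    (by fun_prop) (one_le_toReal hs hst)).trans_eq ?_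
  congr 1
  refine lintegral_congr fun y => ?_
  rw [Real.enorm_of_nonneg (heatKernel_pos ht _).le]

/-- The heat semigroup is a contraction, for finite exponents. -/
theorem eLpNorm_heatConv_le_self {f : ℝ → ℝ} (hf : Measurable f) {t : ℝ} (ht : 0 < t) {s : ℝ≥0∞}
    (hs : 1 ≤ s) (hst : s ≠ ∞) :
    eLpNorm (heatConv f t) s volume ≤ eLpNorm f s volume := by
  refine eLpNorm_heatConv_le_of_lintegral ht hs hst ?_
  have hm := (continuous_heatKernel t).measurable
  rw [eLpNorm_rpow_toReal hs hst]
  have h1 : ∀ x, ∫⁻ y, ‖f y‖ₑ * ENNReal.ofReal (heatKernel t (x - y)) =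
      ∫⁻ y, ENNReal.ofReal (heatKernel t y) * ‖f (x - y)‖ₑ := by
    intro x
    rw [← lintegral_sub_left_eq_self _ x]
    refine lintegral_congr fun y => ?_
    rw [sub_sub_cancel, mul_comm]
  have h2 : ∫⁻ y, ENNReal.ofReal (heatKernel t y) = 1 := by
    have := eLpNorm_heatKernel ht (le_refl 1)
    rw [eLpNorm_one_eq_lintegral_enorm] at this
    simp only [ENNReal.toReal_one, inv_one, Real.one_rpow, sub_self, neg_zero, zero_div,
      Real.rpow_zero, mul_one, ENNReal.ofReal_one] at this
    rw [← this]
    refine lintegral_congr fun y => ?_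
    rw [Real.enorm_of_nonneg (heatKernel_pos ht _).le]
  simp only [h1]
  have h3 := lintegral_lconvolution_rpow_le (f := fun y => ENNReal.ofReal (heatKernel t y))
    (g := fun y => ‖f y‖ₑ) (by fun_prop) hf.enorm (one_le_toReal hs hst)
  rwa [h2, ENNReal.one_rpow, one_mul] at h3

/-- Pointwise, |f|^s ≤ ‖f‖_∞^{s-p} |f|^p. -/
theorem MeasureTheory.MemLp.of_le_exponent_of_top {X : Type*} [MeasurableSpace X] {μ : Measure X}
    {f : X → ℝ} {p s : ℝ≥0∞} (hp0 : p ≠ 0) (hp : MemLp f p μ) (htop : MemLp f ∞ μ) (hps : p ≤ s) :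
    MemLp f s μ := by
  by_cases hst : s = ∞
  · rwa [hst]
  have hpt : p ≠ ∞ := ne_top_of_le_ne_top hst hps
  have hs0 : s ≠ 0 := fun h => hp0 (by simpa [h] using hps)
  refine ⟨hp.1, ?_⟩
  rw [eLpNorm_lt_top_iff_lintegral_rpow_enorm_lt_top hs0 hst]
  have h1 := (eLpNorm_lt_top_iff_lintegral_rpow_enorm_lt_top hp0 hpt).1 hp.2
  have hle : p.toReal ≤ s.toReal := ENNReal.toReal_mono hst hps
  set N := eLpNorm f ∞ μ with hN
  have hNt : N < ∞ := htop.2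
  calc ∫⁻ x, ‖f x‖ₑ ^ s.toReal ∂μ ≤ ∫⁻ x, N ^ (s.toReal - p.toReal) * ‖f x‖ₑ ^ p.toReal ∂μ := by
        refine lintegral_mono_ae ?_
        have hae : ∀ᵐ x ∂μ, ‖f x‖ₑ ≤ N := by
          rw [hN, eLpNorm_exponent_top]; exact enorm_ae_le_eLpNormEssSup f μ
        filter_upwards [hae] with x hx
        calc ‖f x‖ₑ ^ s.toReal = ‖f x‖ₑ ^ (s.toReal - p.toReal) * ‖f x‖ₑ ^ p.toReal := by
              rw [← ENNReal.rpow_add_of_nonneg _ _ (by linarith) ENNReal.toReal_nonneg,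
                sub_add_cancel]
          _ ≤ _ := by gcongr
    _ = N ^ (s.toReal - p.toReal) * ∫⁻ x, ‖f x‖ₑ ^ p.toReal ∂μ :=
        lintegral_const_mul' _ _ (ENNReal.rpow_ne_top_of_nonneg (by linarith) hNt.ne)
    _ < ∞ := ENNReal.mul_lt_top (ENNReal.rpow_lt_top_of_nonneg (by linarith) hNt.ne) h1

/-- Contraction on L^p and the Hölder bound in L^∞ give the two ends; the exponents between follow
by interpolation. -/
theorem memLp_heatConv {p : ℝ≥0∞} (hp : 1 ≤ p) {f : ℝ → ℝ} (hf : MemLp f p volume) {t : ℝ}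
    (ht : 0 < t) {s : ℝ≥0∞} (hps : p ≤ s) : MemLp (heatConv f t) s volume := by
  have hm := aestronglyMeasurable_heatConv hf.1 t
  have := ENNReal.HolderConjugate.conjExponent hp
  have htop : MemLp (heatConv f t) ∞ volume := by
    refine ⟨hm, (eLpNorm_top_heatConv_le (p := p) (q := p.conjExponent) hf.1 t).trans_lt ?_⟩
    exact ENNReal.mul_lt_top hf.2
      (memLp_heatKernel ht (ENNReal.HolderConjugate.symm.one_le p.conjExponent p)).2
  by_cases hpt : p = ∞
  · have : s = ∞ := top_le_iff.1 (hpt ▸ hps)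
    rwa [this]
  have hcongr := heatConv_congr_ae hf.1.ae_eq_mk t
  refine MemLp.of_le_exponent_of_top (zero_lt_one.trans_le hp).ne' ⟨hm, ?_⟩ htop hps
  rw [hcongr]
  refine (eLpNorm_heatConv_le_self hf.1.stronglyMeasurable_mk.measurable ht hp hpt).trans_lt ?_
  rw [← eLpNorm_congr_ae hf.1.ae_eq_mk]
  exact hf.2

/-! ### Reciprocal exponents and identification of the constant -/

theorem toReal_inv_le_one {p : ℝ≥0∞} (hp : 1 ≤ p) : p.toReal⁻¹ ≤ 1 := by
  by_cases hpt : p = ∞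
  · simp [hpt]
  · exact inv_le_one_of_one_le₀ (one_le_toReal hp hpt)

theorem toReal_inv_conjExponent {p q : ℝ≥0∞} [hpq : p.HolderConjugate q] :
    q.toReal⁻¹ = 1 - p.toReal⁻¹ := by
  have h := ENNReal.HolderConjugate.inv_add_inv_eq_one p q
  have hp : p⁻¹ ≠ ∞ := fun h1 => by simp [h1] at h
  have hq : q⁻¹ ≠ ∞ := fun h1 => by simp [h1] at h
  have := congrArg ENNReal.toReal h
  rw [ENNReal.toReal_add hp hq, ENNReal.toReal_inv, ENNReal.toReal_inv, ENNReal.toReal_one] at this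
  linarith

/-- The exponent relation in terms of real reciprocals. -/
theorem toReal_inv_of_young {p q r : ℝ≥0∞} (hp : 1 ≤ p) (hq : 1 ≤ q) (hr : 1 ≤ r)
    (h : 1 / p + 1 / q = 1 + 1 / r) : 1 - q.toReal⁻¹ = p.toReal⁻¹ - r.toReal⁻¹ := by
  have hfin : ∀ {s : ℝ≥0∞}, 1 ≤ s → s⁻¹ ≠ ∞ := fun hs h1 => by
    rw [ENNReal.inv_eq_top] at h1
    simp [h1] at hs
  have := congrArg ENNReal.toReal h
  simp only [one_div] at this
  rw [ENNReal.toReal_add (hfin hp) (hfin hq), ENNReal.toReal_add ENNReal.one_ne_top (hfin hr),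
    ENNReal.toReal_inv, ENNReal.toReal_inv, ENNReal.toReal_inv, ENNReal.toReal_one] at this
  linarith

theorem le_of_young {p q r : ℝ≥0∞} (hq : 1 ≤ q) (h : 1 / p + 1 / q = 1 + 1 / r) : p ≤ r := by
  simp only [one_div] at h
  rw [← ENNReal.inv_le_inv]
  have h1 : q⁻¹ ≤ 1 := ENNReal.inv_le_one.2 hq
  have h2 : 1 + r⁻¹ ≤ 1 + p⁻¹ := by
    rw [← h, add_comm]
    gcongr
  exact (ENNReal.add_le_add_iff_left ENNReal.one_ne_top).1 h2

theorem selfRoot_eq {p : ℝ≥0∞} : selfRoot p = (p.toReal⁻¹ ^ p.toReal⁻¹)⁻¹ := by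
  unfold selfRoot
  split_ifs with h
  · simp [h]
  · rw [one_div, Real.inv_rpow ENNReal.toReal_nonneg, inv_inv]

theorem youngC_eq {p : ℝ≥0∞} (hp : 1 ≤ p) :
    youngC p = (p.toReal⁻¹ ^ p.toReal⁻¹)⁻¹ * (1 - p.toReal⁻¹) ^ (1 - p.toReal⁻¹) := by
  have := ENNReal.HolderConjugate.conjExponent hp
  rw [youngC, selfRoot_eq, selfRoot_eq, toReal_inv_conjExponent (p := p) (q := p.conjExponent),
    div_inv_eq_mul]

theorem heatAlpha_eq {q : ℝ≥0∞} (hq : 1 ≤ q) : heatAlpha q = q.toReal⁻¹ ^ (q.toReal⁻¹ / 2) *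
    (4 * Real.pi) ^ (-(1 - q.toReal⁻¹) / 2) := by
  have h4 : 2 * √Real.pi = (4 * Real.pi) ^ (1 / 2 : ℝ) := by
    rw [← Real.sqrt_eq_rpow, Real.sqrt_mul (by norm_num), show (4 : ℝ) = 2 ^ 2 by norm_num,
      Real.sqrt_sq (by norm_num)]
  unfold heatAlpha
  split_ifs with h1 h2
  · simp [h1]
  · rw [h4, h2, one_div, ← Real.rpow_neg (by positivity)]
    simp
    norm_num
  · have hq0 : 0 < q.toReal := ENNReal.toReal_pos (zero_lt_one.trans_le hq).ne' h2
    rw [h4, ← Real.rpow_mul (by positivity), one_div, mul_inv, ← Real.rpow_neg (by positivity),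
      Real.inv_rpow hq0.le, mul_comm]
    congr 3
    · field_simp
    · ring

/-- With Q = 1/q, the factor Q^{Q/2} of α_q cancels the one in √c_q, and 1 - Q = P - R eliminates q.
-/
theorem heatK_eq {p q r : ℝ≥0∞} (hp : 1 ≤ p) (hq : 1 ≤ q) (hr : 1 ≤ r)
    (h : 1 / p + 1 / q = 1 + 1 / r) : heatK p q r = sharpConst p.toReal⁻¹ r.toReal⁻¹ := by
  have hQ := toReal_inv_of_young hp hq hr h
  rw [heatK, youngC_eq hp, youngC_eq hq, youngC_eq hr, heatAlpha_eq hq,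
    sharpConst_eq (by positivity) (toReal_inv_le_one hr), hQ, ← mul_assoc]
  congr 1
  set P := p.toReal⁻¹
  set Q := q.toReal⁻¹
  set R := r.toReal⁻¹
  have hQ0 : 0 ≤ Q := by positivity
  have hR0 : 0 ≤ R := by positivity
  have pQ := rpow_self_pos hQ0
  have pR := rpow_self_pos hR0
  have e1 : Q ^ (Q / 2) = √(Q ^ Q) := by
    rw [Real.sqrt_eq_rpow, ← Real.rpow_mul hQ0]; congr 1; ring
  rw [e1, ← Real.sqrt_mul' _ pQ.le]
  congr 1
  field_simp

theorem sharpConst_self {P : ℝ} (hP : 0 ≤ P) (hP1 : P ≤ 1) : sharpConst P P = 1 := by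
  have h1 := rpow_self_pos hP
  have h2 := rpow_self_pos (sub_nonneg.2 hP1)
  rw [sharpConst_eq hP hP1]
  have : (P ^ P)⁻¹ * (1 - P) ^ (1 - P) * (P - P) ^ (P - P) * P ^ P * ((1 - P) ^ (1 - P))⁻¹ = 1 := by
    rw [sub_self, Real.rpow_zero]; field_simp
  rw [this]
  simp

theorem sharpConst_zero_right {P : ℝ} (hP : 0 ≤ P) (hP1 : P ≤ 1) :
    sharpConst P 0 = (1 - P) ^ ((1 - P) / 2) * (4 * Real.pi) ^ (-P / 2) := by
  have h1 := rpow_self_pos hP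
  have h2 := sub_nonneg.2 hP1
  rw [sharpConst_eq hP zero_le_one]
  have : (P ^ P)⁻¹ * (1 - P) ^ (1 - P) * (P - 0) ^ (P - 0) * (0 : ℝ) ^ (0 : ℝ) *
      ((1 - 0 : ℝ) ^ (1 - 0 : ℝ))⁻¹ = (1 - P) ^ (1 - P) := by
    simp only [sub_zero, Real.rpow_zero, Real.one_rpow]; field_simp
  rw [this, Real.sqrt_eq_rpow, ← Real.rpow_mul h2, sub_zero]
  congr 2
  ring

theorem sharpConst_one_left {R : ℝ} (hR : 0 ≤ R) (hR1 : R ≤ 1) :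
    sharpConst 1 R = R ^ (R / 2) * (4 * Real.pi) ^ (-(1 - R) / 2) := by
  have h1 := rpow_self_pos hR
  have h2 := rpow_self_pos (sub_nonneg.2 hR1)
  rw [sharpConst_eq zero_le_one hR1]
  have : ((1 : ℝ) ^ (1 : ℝ))⁻¹ * (1 - 1 : ℝ) ^ (1 - 1 : ℝ) * (1 - R) ^ (1 - R) * R ^ R *
      ((1 - R) ^ (1 - R))⁻¹ = R ^ R := by
    simp only [sub_self, Real.rpow_zero, Real.one_rpow]; field_simp
  rw [this, Real.sqrt_eq_rpow, ← Real.rpow_mul hR]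
  congr 2
  ring

/-! ### The sharp smoothing estimate -/

/-- The sharp estimate for nonnegative functions and exponents `1 < p < r < ∞`. -/
theorem eLpNorm_heatConv_le_of_interior {p r : ℝ≥0∞} (hp : 1 < p) (hpr : p < r) (hrt : r ≠ ∞)
    {f : ℝ → ℝ} (hfm : Measurable f) (hf0 : ∀ x, 0 ≤ f x) (hf : MemLp f p volume) {t : ℝ}
    (ht : 0 < t) :
    eLpNorm (heatConv f t) r volume ≤ ENNReal.ofReal
      (sharpConst p.toReal⁻¹ r.toReal⁻¹ * t ^ (-(p.toReal⁻¹ - r.toReal⁻¹) / 2)) *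
        eLpNorm f p volume := by
  have hpt : p ≠ ∞ := hpr.ne_top
  have hp0 : p ≠ 0 := (zero_lt_one.trans hp).ne'
  have hr0 : r ≠ 0 := (zero_lt_one.trans (hp.trans hpr)).ne'
  have hpr1 : 1 < p.toReal := by
    have := (ENNReal.toReal_lt_toReal ENNReal.one_ne_top hpt).2 hp
    simpa using this
  have hrr : p.toReal < r.toReal := (ENNReal.toReal_lt_toReal hpt hrt).2 hpr
  have hprp : 0 < p.toReal := by linarith
  have hrrp : 0 < r.toReal := by linarith
  set P := p.toReal⁻¹ with hP
  set R := r.toReal⁻¹ with hR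
  have hR0 : 0 < R := inv_pos.2 hrrp
  have hP0 : 0 < P := inv_pos.2 hprp
  have hRP : R < P := inv_strictAnti₀ hprp hrr
  have hP1 : P < 1 := inv_lt_one_of_one_lt₀ hpr1
  set u := heatConv f t with hu
  have hker := continuous_heatKernel t
  have hum : Measurable u := by
    have h1 : StronglyMeasurable (fun z : ℝ × ℝ => f z.2 * heatKernel t (z.1 - z.2)) :=
      Measurable.stronglyMeasurable (by have := hker.measurable; fun_prop)
    exact h1.integral_prod_right'.measurable
  have hu0 : ∀ x, 0 ≤ u x := fun x =>
    integral_nonneg fun y => mul_nonneg (hf0 y) (heatKernel_pos ht _).le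
  have huL : MemLp u r volume := memLp_heatConv hp.le hf ht hpr.le
  have hFi : Integrable (fun x => f x ^ p.toReal) := by
    have := hf.integrable_norm_rpow hp0 hpt
    refine this.congr (Eventually.of_forall fun x => ?_)
    simp only
    rw [Real.norm_of_nonneg (hf0 x)]
  have hHi : Integrable (fun x => u x ^ r.toReal) := by
    have := huL.integrable_norm_rpow hr0 hrt
    refine this.congr (Eventually.of_forall fun x => ?_)
    simp only
    rw [Real.norm_of_nonneg (hu0 x)]
  -- With F = f^p and H = u^r the bilinear form equals ∫ u^r, since r(1-R) + 1 = r. The estimate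
  -- becomes ∫u^r ≤ κ ‖f‖_p (∫u^r)^{1-R}, and division is legitimate because u is already known to
  -- lie in L^r.
  have key := lintegral_rpow_mul_rpow_mul_heatKernel_le hR0 hRP hP1 ht
    (hfm.pow_const p.toReal) (hum.pow_const r.toReal) (fun x => Real.rpow_nonneg (hf0 x) _)
    (fun x => Real.rpow_nonneg (hu0 x) _) hFi hHi
  have hE : r.toReal * (1 - R) = r.toReal - 1 := by
    rw [hR, mul_sub, mul_inv_cancel₀ hrrp.ne', mul_one]
  have e1 : ∀ x y, (f x ^ p.toReal) ^ P * (u y ^ r.toReal) ^ (1 - R) * heatKernel t (y - x) =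
      u y ^ (r.toReal - 1) * (f x * heatKernel t (y - x)) := by
    intro x y
    rw [← Real.rpow_mul (hf0 x), ← Real.rpow_mul (hu0 y), hE, hP, mul_inv_cancel₀ hprp.ne',
      Real.rpow_one]
    ring
  simp only [e1] at key
  rw [lintegral_lintegral_swap (by have := hker.measurable; fun_prop)] at key
  have e2 : ∀ y, ∫⁻ x, ENNReal.ofReal (u y ^ (r.toReal - 1) * (f x * heatKernel t (y - x))) =
      ENNReal.ofReal (u y ^ r.toReal) := by
    intro y
    have h1 : ∀ x, ENNReal.ofReal (u y ^ (r.toReal - 1) * (f x * heatKernel t (y - x))) =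
        ENNReal.ofReal (u y ^ (r.toReal - 1)) * ENNReal.ofReal (f x * heatKernel t (y - x)) :=
      fun x => ENNReal.ofReal_mul (Real.rpow_nonneg (hu0 y) _)
    have hci : Integrable (fun x => f x * heatKernel t (y - x)) :=
      convolutionExists_heatKernel hp.le hf ht y
    simp only [h1]
    rw [lintegral_const_mul' _ _ ENNReal.ofReal_ne_top,
      ← ofReal_integral_eq_lintegral_ofReal hci
        (Eventually.of_forall fun x => mul_nonneg (hf0 x) (heatKernel_pos ht _).le)]
    rw [← ENNReal.ofReal_mul (Real.rpow_nonneg (hu0 y) _)]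
    congr 1
    have h2 : (∫ x, f x * heatKernel t (y - x)) = u y := rfl
    rw [h2]
    have h3 : u y ^ (r.toReal - 1) * u y ^ (1 : ℝ) = u y ^ r.toReal := by
      rw [← Real.rpow_add_of_nonneg (hu0 y) (by linarith) zero_le_one, sub_add_cancel]
    rwa [Real.rpow_one] at h3
  simp only [e2] at key
  rw [← ofReal_integral_eq_lintegral_ofReal hHi
    (Eventually.of_forall fun y => Real.rpow_nonneg (hu0 y) _)] at key
  set I := ∫ y, u y ^ r.toReal with hI
  set A := ∫ x, f x ^ p.toReal with hA
  have hI0 : 0 ≤ I := integral_nonneg fun y => Real.rpow_nonneg (hu0 y) _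
  have hA0 : 0 ≤ A := integral_nonneg fun y => Real.rpow_nonneg (hf0 y) _
  set κ := sharpConst P R * t ^ (-(P - R) / 2) with hκ
  have hκ0 : 0 ≤ κ := (mul_pos (sharpConst_pos hR0.le hRP.le hP1.le) (Real.rpow_pos_of_pos ht _)).le
  have key' : I ≤ κ * (A ^ P * I ^ (1 - R)) :=
    (ENNReal.ofReal_le_ofReal_iff (by positivity)).1 key
  have hfin : I ^ R ≤ κ * A ^ P := by
    rcases hI0.eq_or_lt with h0 | hpos
    · rw [← h0, Real.zero_rpow hR0.ne']; positivity
    · have h1 : 0 < I ^ (1 - R) := Real.rpow_pos_of_pos hpos _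
      have h2 : I = I ^ R * I ^ (1 - R) := by
        rw [← Real.rpow_add hpos, add_sub_cancel, Real.rpow_one]
      refine le_of_mul_le_mul_right ?_ h1
      rw [← h2]
      linarith
  rw [huL.eLpNorm_eq_integral_rpow_norm hr0 hrt, hf.eLpNorm_eq_integral_rpow_norm hp0 hpt,
    ← ENNReal.ofReal_mul hκ0]
  refine ENNReal.ofReal_le_ofReal ?_
  simp only [Real.norm_of_nonneg (hu0 _), Real.norm_of_nonneg (hf0 _)]
  exact hfin

/-- The sharp `L^p`–`L^r` smoothing estimate for the heat semigroup. -/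
theorem eLpNorm_heatConv_le {p r : ℝ≥0∞} (hp : 1 ≤ p) (hpr : p ≤ r) {f : ℝ → ℝ}
    (hf : MemLp f p volume) {t : ℝ} (ht : 0 < t) :
    eLpNorm (heatConv f t) r volume ≤ ENNReal.ofReal
      (sharpConst p.toReal⁻¹ r.toReal⁻¹ * t ^ (-(p.toReal⁻¹ - r.toReal⁻¹) / 2)) *
        eLpNorm f p volume := by
  have hP0 : 0 ≤ p.toReal⁻¹ := by positivity
  have hR0 : 0 ≤ r.toReal⁻¹ := by positivity
  have hP1 := toReal_inv_le_one hp
  have hR1 := toReal_inv_le_one (hp.trans hpr)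
  set g := hf.1.mk f with hg
  have hgm : Measurable g := hf.1.stronglyMeasurable_mk.measurable
  have hfg : f =ᵐ[volume] g := hf.1.ae_eq_mk
  by_cases hrt : r = ∞
  · subst hrt
    have := ENNReal.HolderConjugate.conjExponent hp
    refine (eLpNorm_top_heatConv_le (p := p) (q := p.conjExponent) hf.1 t).trans_eq ?_
    rw [eLpNorm_heatKernel ht (ENNReal.HolderConjugate.symm.one_le p.conjExponent p), mul_comm,
      toReal_inv_conjExponent (p := p) (q := p.conjExponent)]
    congr 2
    simp only [ENNReal.toReal_top, inv_zero, sub_zero]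
    rw [sharpConst_zero_right hP0 hP1]
    simp
  rw [heatConv_congr_ae hfg, eLpNorm_congr_ae hfg]
  have hgL : MemLp g p volume := (memLp_congr_ae hfg).1 hf
  rcases hpr.eq_or_lt with rfl | hlt
  · rw [sharpConst_self hP0 hP1]
    simpa using eLpNorm_heatConv_le_self hgm ht hp hrt
  rcases hp.eq_or_lt with rfl | hp'
  · refine (eLpNorm_heatConv_le_of_one hgm ht hpr hrt).trans_eq ?_
    rw [eLpNorm_heatKernel ht hpr, mul_comm, ENNReal.toReal_one, inv_one,
      sharpConst_one_left hR0 hR1]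
  -- Positivity of the kernel gives |g ∗ Θ_t| ≤ |g| ∗ Θ_t, which reduces to nonnegative functions.
  · have h1 := eLpNorm_heatConv_le_of_interior hp' hlt hrt hgm.abs (fun x => abs_nonneg _) hgL.abs ht
    have h2 : eLpNorm (fun x => |g x|) p volume = eLpNorm g p volume := eLpNorm_norm g
    rw [h2] at h1
    refine le_trans (eLpNorm_mono_real fun x => ?_) h1
    rw [heatConv_apply, heatConv_apply]
    refine (norm_integral_le_integral_norm _).trans_eq ?_
    congr 1
    funext y
    rw [norm_mul, Real.norm_eq_abs, Real.norm_of_nonneg (heatKernel_pos ht _).le]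

/-! ### Gaussians and optimality of the constant -/

theorem heatConv_gaussian {k t : ℝ} (hk : 0 < k) (ht : 0 < t) :
    heatConv (fun x => Real.exp (-k * x ^ 2)) t =
      (1 + 4 * k * t) ^ (-(1 / 2) : ℝ) • fun x => Real.exp (-(k / (1 + 4 * k * t)) * x ^ 2) := by
  funext x
  have hu : 0 < 1 + 4 * k * t := by positivity
  have h1 : ∀ y, Real.exp (-k * y ^ 2) * heatKernel t (x - y) =
      Real.exp (-(Real.log (4 * Real.pi * t) / 2) - k / (1 + 4 * k * t) * x ^ 2) *
        Real.exp (-((1 + 4 * k * t) / (4 * t)) * (y - x / (1 + 4 * k * t)) ^ 2) := by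
    intro y
    rw [heatKernel_eq_exp ht, ← Real.exp_add, ← Real.exp_add]
    congr 1
    field_simp
    ring
  rw [heatConv_apply]
  simp only [h1]
  rw [integral_const_mul, integral_sub_right_eq_self
    (fun y => Real.exp (-((1 + 4 * k * t) / (4 * t)) * y ^ 2)), integral_gaussian, Pi.smul_apply,
    smul_eq_mul, Real.rpow_def_of_pos hu, ← Real.exp_add,
    ← Real.exp_log (Real.sqrt_pos.2 (by positivity : 0 < Real.pi / ((1 + 4 * k * t) / (4 * t)))),
    ← Real.exp_add, Real.log_sqrt (by positivity)]
  congr 1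
  rw [show Real.pi / ((1 + 4 * k * t) / (4 * t)) = 4 * Real.pi * t / (1 + 4 * k * t) by field_simp,
    Real.log_div (by positivity) hu.ne']
  ring

theorem memLp_gaussian {k : ℝ} (hk : 0 < k) {p : ℝ≥0∞} (hp : 1 ≤ p) :
    MemLp (fun x : ℝ => Real.exp (-k * x ^ 2)) p volume :=
  ⟨(by fun_prop : Continuous fun x : ℝ => Real.exp (-k * x ^ 2)).aestronglyMeasurable, by
    rw [eLpNorm_gaussian hk hp]; exact ENNReal.ofReal_lt_top⟩

theorem eLpNorm_heatConv_gaussian {k t : ℝ} (hk : 0 < k) (ht : 0 < t) {r : ℝ≥0∞} (hr : 1 ≤ r) :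
    eLpNorm (heatConv (fun x => Real.exp (-k * x ^ 2)) t) r volume =
      ENNReal.ofReal ((1 + 4 * k * t) ^ (-(1 / 2) : ℝ) *
        (Real.pi * r.toReal⁻¹ / (k / (1 + 4 * k * t))) ^ (r.toReal⁻¹ / 2)) := by
  rw [heatConv_gaussian hk ht, eLpNorm_const_smul, eLpNorm_gaussian (by positivity) hr,
    Real.enorm_of_nonneg (by positivity), ← ENNReal.ofReal_mul (by positivity)]

/-- The quotient of norms for the Gaussian with parameter `w = 4kt / (1 + 4kt)`, normalised by the
power of `t`. -/
noncomputable def gaussianQuotient (P R w : ℝ) : ℝ :=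
  √(R ^ R * (P ^ P)⁻¹) * (4 * Real.pi) ^ (-(P - R) / 2) * (w ^ ((P - R) / 2) * (1 - w) ^ ((1 - P) / 2))

/-- The point (P-R)/(1-R) maximises w^{(P-R)/2} (1-w)^{(1-P)/2} on [0, 1]. For R = 1, which forces P
= 1, the quotient is 0/0 = 0 and both sides are 1. -/
theorem gaussianQuotient_eq {P R : ℝ} (hR : 0 ≤ R) (hRP : R ≤ P) (hP : P ≤ 1) :
    gaussianQuotient P R ((P - R) / (1 - R)) = sharpConst P R := by
  have hP0 := hR.trans hRP
  have h1 := rpow_self_pos hP0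
  have h2 := rpow_self_pos hR
  rcases (hRP.trans hP).eq_or_lt with rfl | hR1
  · obtain rfl : P = 1 := le_antisymm hP hRP
    rw [sharpConst_self zero_le_one le_rfl]
    simp [gaussianQuotient]
  · have hQ : 0 ≤ P - R := sub_nonneg.2 hRP
    have hR' : 0 < 1 - R := by linarith
    have hP' : 0 ≤ 1 - P := by linarith
    have e1 : 1 - (P - R) / (1 - R) = (1 - P) / (1 - R) := by field_simp; ring
    have hs : ∀ x y : ℝ, 0 ≤ x → x ^ (y / 2) = √(x ^ y) := fun x y hx => by
      rw [Real.sqrt_eq_rpow, ← Real.rpow_mul hx]; congr 1; ring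
    rw [gaussianQuotient, sharpConst_eq hP0 hR1.le, e1,
      hs ((P - R) / (1 - R)) (P - R) (by positivity), hs ((1 - P) / (1 - R)) (1 - P) (by positivity), ← Real.sqrt_mul (by positivity), mul_right_comm, ← Real.sqrt_mul (by positivity),
      Real.div_rpow hQ hR'.le, Real.div_rpow hP' hR'.le]
    congr 2
    have e2 : (1 - R) ^ (1 - R) = (1 - R) ^ (P - R) * (1 - R) ^ (1 - P) := by
      rw [← Real.rpow_add hR']; congr 1; ring
    rw [e2]
    have := Real.rpow_pos_of_pos hR' (P - R)
    have := Real.rpow_pos_of_pos hR' (1 - P)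
    field_simp

/-- Here k = w/((1-w)4t) inverts w = 4kt/(1+4kt). The identity says that quotient × norm of the
Gaussian × power of t is the norm of its heat evolution. -/
theorem gaussianQuotient_mul {P R w t : ℝ} (hR : 0 ≤ R) (hRP : R ≤ P) (hw : 0 < w) (hw1 : w < 1)
    (ht : 0 < t) :
    gaussianQuotient P R w * (Real.pi * P / (w / ((1 - w) * (4 * t)))) ^ (P / 2) * t ^ (-(P - R) / 2) =
      (1 + 4 * (w / ((1 - w) * (4 * t))) * t) ^ (-(1 / 2) : ℝ) *
        (Real.pi * R / (w / ((1 - w) * (4 * t)) / (1 + 4 * (w / ((1 - w) * (4 * t))) * t))) ^ (R / 2) := by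
  have hw' : 0 < 1 - w := by linarith
  have hP := hR.trans hRP
  have h1 := rpow_self_pos hP
  have e1 : 1 + 4 * (w / ((1 - w) * (4 * t))) * t = (1 - w)⁻¹ := by field_simp; ring
  set D := 4 * Real.pi * t * (1 - w) / w with hD
  have hD0 : 0 < D := by positivity
  have e2 : Real.pi * P / (w / ((1 - w) * (4 * t))) = P * D := by rw [hD]; field_simp
  have e3 : Real.pi * R / (w / ((1 - w) * (4 * t)) / (1 - w)⁻¹) = R * (D * (1 - w)⁻¹) := by
    rw [hD]; field_simp
  have hs : ∀ x : ℝ, 0 ≤ x → x ^ (x / 2) = √(x ^ x) := fun x hx => by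
    rw [Real.sqrt_eq_rpow, ← Real.rpow_mul hx]; congr 1; ring
  rw [e1, e2, e3, Real.mul_rpow hP hD0.le, Real.mul_rpow hR (by positivity), hs P hP, hs R hR,
    gaussianQuotient, Real.sqrt_mul (rpow_self_pos hR).le, Real.sqrt_inv]
  have hsp : √(P ^ P) ≠ 0 := (Real.sqrt_pos.2 h1).ne'
  have e4 : (4 * Real.pi) ^ (-(P - R) / 2) * (w ^ ((P - R) / 2) * (1 - w) ^ ((1 - P) / 2)) * D ^ (P / 2)
      * t ^ (-(P - R) / 2) = (1 - w)⁻¹ ^ (-(1 / 2) : ℝ) * (D * (1 - w)⁻¹) ^ (R / 2) := by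
    have hl : Real.log D = Real.log (4 * Real.pi) + Real.log t + Real.log (1 - w) - Real.log w := by
      rw [hD, Real.log_div (by positivity) hw.ne', Real.log_mul (by positivity) hw'.ne',
        Real.log_mul (by positivity) ht.ne']
    simp only [Real.rpow_def_of_pos (by positivity : 0 < 4 * Real.pi), Real.rpow_def_of_pos hw,
      Real.rpow_def_of_pos hw', Real.rpow_def_of_pos hD0, Real.rpow_def_of_pos ht,
      Real.rpow_def_of_pos (inv_pos.2 hw'), Real.rpow_def_of_pos (mul_pos hD0 (inv_pos.2 hw')),
      ← Real.exp_add]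
    congr 1
    rw [Real.log_mul hD0.ne' (inv_pos.2 hw').ne', Real.log_inv, hl]
    ring
  calc _ = √(R ^ R) * ((√(P ^ P))⁻¹ * √(P ^ P)) * ((4 * Real.pi) ^ (-(P - R) / 2) *
        (w ^ ((P - R) / 2) * (1 - w) ^ ((1 - P) / 2)) * D ^ (P / 2) * t ^ (-(P - R) / 2)) := by ring
    _ = _ := by rw [e4, inv_mul_cancel₀ hsp]; ring

/-- The constant in the smoothing estimate is optimal, at every time. -/
theorem exists_lt_eLpNorm_heatConv {p r : ℝ≥0∞} (hp : 1 ≤ p) (hpr : p ≤ r) {C : ℝ}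
    (hC : C < sharpConst p.toReal⁻¹ r.toReal⁻¹) {t : ℝ} (ht : 0 < t) :
    ∃ f : ℝ → ℝ, MemLp f p volume ∧
      ENNReal.ofReal C * eLpNorm f p volume *
        ENNReal.ofReal (t ^ (-(p.toReal⁻¹ - r.toReal⁻¹) / 2)) < eLpNorm (heatConv f t) r volume := by
  have hr : 1 ≤ r := hp.trans hpr
  have hR0 : 0 ≤ r.toReal⁻¹ := by positivity
  have hP0 : 0 ≤ p.toReal⁻¹ := by positivity
  have hP1 := toReal_inv_le_one hp
  have hRP : r.toReal⁻¹ ≤ p.toReal⁻¹ := by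
    have := ENNReal.inv_le_inv.2 hpr
    have h2 : p⁻¹ ≠ ∞ := by
      rw [Ne, ENNReal.inv_eq_top]; exact (zero_lt_one.trans_le hp).ne'
    simpa [ENNReal.toReal_inv] using ENNReal.toReal_mono h2 this
  set P := p.toReal⁻¹ with hP
  set R := r.toReal⁻¹ with hR
  have hcont : Continuous (gaussianQuotient P R) := by
    unfold gaussianQuotient
    refine continuous_const.mul (Continuous.mul ?_ ?_)
    · exact continuous_id.rpow_const fun _ => Or.inr (by linarith)
    · exact (continuous_const.sub continuous_id).rpow_const fun _ => Or.inr (by linarith)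
  have hmax : max C 0 < gaussianQuotient P R ((P - R) / (1 - R)) := by
    rw [gaussianQuotient_eq hR0 hRP hP1]
    exact max_lt hC (sharpConst_pos hR0 hRP hP1)
  -- The optimal w may be 0 (as for p = r) or 1 (as for p = 1 < r), where no Gaussian corresponds to
  -- it. By continuity a nearby w inside (0, 1) still beats C; comparing with max C 0 also keeps the
  -- quotient positive.
  have hmem : (P - R) / (1 - R) ∈ closure (Set.Ioo (0 : ℝ) 1) := by
    rw [closure_Ioo zero_ne_one]
    exact ⟨div_nonneg (by linarith) (by linarith), div_le_one_of_le₀ (by linarith) (by linarith)⟩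
  obtain ⟨w, hwC, hw0, hw1⟩ := mem_closure_iff.1 hmem _ (isOpen_lt continuous_const hcont) hmax
  have hw' : 0 < 1 - w := by linarith
  have hk : 0 < w / ((1 - w) * (4 * t)) := by positivity
  refine ⟨_, memLp_gaussian hk hp, ?_⟩
  rw [eLpNorm_gaussian hk hp, eLpNorm_heatConv_gaussian hk ht hr, ← hP, ← hR,
    ← gaussianQuotient_mul hR0 hRP hw0 hw1 ht, ← ENNReal.ofReal_mul' (by positivity),
    ← ENNReal.ofReal_mul' (by positivity)]
  have hn : 0 < (Real.pi * P / (w / ((1 - w) * (4 * t)))) ^ (P / 2) := by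
    rcases hP0.eq_or_lt with h0 | h0
    · rw [← h0]; simp
    · positivity
  have hq : 0 < gaussianQuotient P R w := (le_max_right _ _).trans_lt hwC
  refine (ENNReal.ofReal_lt_ofReal_iff (by positivity)).2 ?_
  gcongr
  exact (le_max_left _ _).trans_lt hwC

/-! ### Sharpness of the rate by uniform boundedness -/

/-- The heat semigroup at time `t` as a bounded operator from `L^p` to `L^r`. -/
noncomputable def heatOp (p r : ℝ≥0∞) [Fact (1 ≤ p)] [Fact (1 ≤ r)] (hpr : p ≤ r) {t : ℝ} (ht : 0 < t) :
    Lp ℝ p (volume : Measure ℝ) →L[ℝ] Lp ℝ r (volume : Measure ℝ) :=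
  LinearMap.mkContinuous
    { toFun := fun f => (memLp_heatConv Fact.out (Lp.memLp f) ht hpr).toLp (heatConv f t)
      map_add' := fun f g => by
        rw [← MemLp.toLp_add]
        apply MemLp.toLp_congr
        rw [heatConv_congr_ae (Lp.coeFn_add f g)]
        exact EventuallyEq.of_eq
          ((convolutionExists_heatKernel Fact.out (Lp.memLp f) ht).add_distrib
            (convolutionExists_heatKernel Fact.out (Lp.memLp g) ht))
      map_smul' := fun c f => by
        rw [RingHom.id_apply, ← MemLp.toLp_const_smul]
        apply MemLp.toLp_congr
        rw [heatConv_congr_ae (Lp.coeFn_smul c f)]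
        exact EventuallyEq.of_eq smul_convolution }
    (ENNReal.ofReal (sharpConst p.toReal⁻¹ r.toReal⁻¹ *
      t ^ (-(p.toReal⁻¹ - r.toReal⁻¹) / 2))).toReal
    (fun f => by
      have hp : 1 ≤ p := Fact.out
      simp only [LinearMap.coe_mk, AddHom.coe_mk]
      rw [Lp.norm_toLp, Lp.norm_def, ← ENNReal.toReal_mul]
      exact ENNReal.toReal_mono (ENNReal.mul_ne_top ENNReal.ofReal_ne_top (Lp.memLp f).2.ne)
        (eLpNorm_heatConv_le hp hpr (Lp.memLp f) ht))

theorem norm_heatOp_apply {p r : ℝ≥0∞} [Fact (1 ≤ p)] [Fact (1 ≤ r)] (hpr : p ≤ r) {t : ℝ}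
    (ht : 0 < t) (f : Lp ℝ p (volume : Measure ℝ)) :
    ‖heatOp p r hpr ht f‖ = (eLpNorm (heatConv f t) r volume).toReal :=
  Lp.norm_toLp _ (memLp_heatConv Fact.out (Lp.memLp f) ht hpr)

/-- No rate that is negligible against the sharp one controls the whole of `L^p`. -/
theorem exists_not_isBoundedUnder {p r : ℝ≥0∞} (hp : 1 ≤ p) (hpr : p ≤ r) {l : Filter ℝ} [l.NeBot]
    [l.IsCountablyGenerated] (hl : ∀ᶠ t in l, 0 < t) {ψ : ℝ → ℝ} (hψ0 : ∀ t, 0 < t → 0 < ψ t)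
    (hψ : ψ =o[l] fun t => t ^ (-(p.toReal⁻¹ - r.toReal⁻¹) / 2)) :
    ∃ G : ℝ → ℝ, MemLp G p volume ∧ ¬ IsBoundedUnder (· ≤ ·) l
      (fun t : ℝ => (eLpNorm (heatConv G t) r volume).toReal / ψ t) := by
  have hr : 1 ≤ r := hp.trans hpr
  have : Fact (1 ≤ p) := ⟨hp⟩
  have : Fact (1 ≤ r) := ⟨hr⟩
  by_contra! hcon
  -- Along a sequence of positive times tending to l, the operators divided by ψ are pointwise
  -- bounded, hence bounded in norm by some C.
  obtain ⟨u, hu⟩ := l.exists_seq_tendsto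
  obtain ⟨N, hN⟩ := eventually_atTop.1 (hu.eventually hl)
  set v : ℕ → ℝ := fun n => u (n + N) with hv
  have hvl : Tendsto v atTop l := hu.comp (tendsto_add_atTop_nat N)
  have hv0 : ∀ n, 0 < v n := fun n => hN _ (Nat.le_add_left _ _)
  obtain ⟨C, hC⟩ := banach_steinhaus
    (g := fun n => (ψ (v n))⁻¹ • heatOp p r hpr (hv0 n)) (fun f => by
      have hb : IsBoundedUnder (· ≤ ·) atTop ((fun t : ℝ =>
          (eLpNorm (heatConv f t) r volume).toReal / ψ t) ∘ v) :=
        IsBounded.mono (map_map.symm.le.trans (map_mono hvl)) (hcon f (Lp.memLp f))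
      obtain ⟨B, hB⟩ := hb.bddAbove_range
      refine ⟨B, fun n => ?_⟩
      have := hB ⟨n, rfl⟩
      simp only [Function.comp] at this
      rw [smul_apply, norm_smul, norm_heatOp_apply,
        Real.norm_of_nonneg (inv_pos.2 (hψ0 _ (hv0 n))).le, mul_comm, ← div_eq_mul_inv]
      exact this)
  have hR0 : 0 ≤ r.toReal⁻¹ := by positivity
  set K := sharpConst p.toReal⁻¹ r.toReal⁻¹ with hK
  have hK0 : 0 < K := by
    refine sharpConst_pos hR0 ?_ (toReal_inv_le_one hp)
    have h2 : p⁻¹ ≠ ∞ := by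
      rw [Ne, ENNReal.inv_eq_top]; exact (zero_lt_one.trans_le hp).ne'
    simpa [ENNReal.toReal_inv] using ENNReal.toReal_mono h2 (ENNReal.inv_le_inv.2 hpr)
  have hC0 : 0 ≤ C := (norm_nonneg _).trans (hC 0)
  -- Chosen so that ψ · C ≤ (K/2) × rate at a late term of the sequence, against an f whose quotient
  -- exceeds K/2 at that same time. This is why optimality is needed at every t.
  have hc : 0 < K / (2 * (C + 1)) := by positivity
  obtain ⟨n, hn⟩ := (hvl.eventually (hψ.def hc)).exists
  have ht := hv0 n
  have hψn := hψ0 _ ht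
  rw [Real.norm_of_nonneg hψn.le, Real.norm_of_nonneg (Real.rpow_nonneg ht.le _)] at hn
  obtain ⟨f, hf, hlt⟩ := exists_lt_eLpNorm_heatConv hp hpr (half_lt_self hK0) ht
  set ρ := v n ^ (-(p.toReal⁻¹ - r.toReal⁻¹) / 2) with hρ
  have hρ0 : 0 < ρ := Real.rpow_pos_of_pos ht _
  have h1 := ((((ψ (v n))⁻¹ • heatOp p r hpr ht).le_opNorm (hf.toLp f)).trans
    (mul_le_mul_of_nonneg_right (hC n) (norm_nonneg _)))
  rw [smul_apply, norm_smul, norm_heatOp_apply, Lp.norm_toLp,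
    Real.norm_of_nonneg (inv_pos.2 hψn).le, heatConv_congr_ae hf.coeFn_toLp] at h1
  have hfin := (memLp_heatConv hp hf ht hpr).2.ne
  have h2 := (ENNReal.toReal_lt_toReal (ne_top_of_lt hlt) hfin).2 hlt
  rw [ENNReal.toReal_mul, ENNReal.toReal_mul, ENNReal.toReal_ofReal (by positivity),
    ENNReal.toReal_ofReal hρ0.le] at h2
  set a := (eLpNorm f p volume).toReal with ha
  have ha0 : 0 ≤ a := ENNReal.toReal_nonneg
  rw [inv_mul_le_iff₀ hψn] at h1
  have h3 : ψ (v n) * (C * a) ≤ K / 2 * a * ρ := by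
    calc ψ (v n) * (C * a) ≤ K / (2 * (C + 1)) * ρ * ((C + 1) * a) := by gcongr; linarith
      _ = K / 2 * a * ρ := by field_simp
  linarith

/-! ### No gain of decay: part (c) -/

/-- Only y within distance 1 of x is kept: there 1 + |y| ≤ 2 + |x| and the kernel is at least its
value at 1. -/
theorem rpow_add_two_le_heatConv {b t : ℝ} (hb : 0 ≤ b) (ht : 0 < t)
    (hinteg : ∀ x, Integrable (fun y : ℝ => (1 + |y|) ^ (-b) * heatKernel t (x - y))) (x : ℝ) :
    2 * heatKernel t 1 * (2 + |x|) ^ (-b) ≤ heatConv (fun y : ℝ => (1 + |y|) ^ (-b)) t x := by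
  have hpos : ∀ y : ℝ, 0 ≤ (1 + |y|) ^ (-b) * heatKernel t (x - y) := fun y =>
    mul_nonneg (by positivity) (heatKernel_pos ht _).le
  rw [heatConv_apply]
  refine le_trans ?_ (setIntegral_le_integral (s := Set.Icc (x - 1) (x + 1)) (hinteg x)
    (Eventually.of_forall hpos))
  have h1 : ∫ _ in Set.Icc (x - 1) (x + 1), (2 + |x|) ^ (-b) * heatKernel t 1 =
      2 * heatKernel t 1 * (2 + |x|) ^ (-b) := by
    rw [setIntegral_const, measureReal_def, Real.volume_Icc, ENNReal.toReal_ofReal (by linarith),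
      smul_eq_mul]
    ring
  rw [← h1]
  refine setIntegral_mono_on (integrableOn_const (by simp)) (hinteg x).integrableOn measurableSet_Icc
    fun y hy => ?_
  have hxy : |x - y| ≤ 1 := by rw [abs_le]; constructor <;> linarith [hy.1, hy.2]
  have hyx : 1 + |y| ≤ 2 + |x| := by
    have : |y| ≤ |x| + |x - y| := by
      have := abs_sub_abs_le_abs_sub y x
      rw [abs_sub_comm] at this
      linarith
    linarith
  refine mul_le_mul (Real.rpow_le_rpow_of_nonpos (by positivity) hyx (by linarith)) ?_
    (heatKernel_pos ht _).le (by positivity)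
  unfold heatKernel
  have hsq : (x - y) ^ 2 ≤ 1 ^ 2 := sq_le_sq.2 (by simpa using hxy)
  gcongr

theorem not_integrable_inv_two_add_abs : ¬ Integrable (fun x : ℝ => (2 + |x|)⁻¹) := by
  intro h
  refine not_integrableOn_Ioi_inv (a := 2) ?_
  refine (h.integrableOn.const_mul 2).mono' measurable_inv.aestronglyMeasurable ?_
  filter_upwards [ae_restrict_mem measurableSet_Ioi] with x hx
  have hx2 : 2 < x := hx
  have hx0 : 0 < x := by linarith
  rw [Real.norm_of_nonneg (by positivity), abs_of_pos hx0, ← div_eq_mul_inv, inv_eq_one_div,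
    div_le_div_iff₀ hx0 (by linarith)]
  linarith

/-- The heat semigroup does not improve decay. -/
theorem exists_forall_not_memLp_heatConv {p s : ℝ≥0∞} (hs : 1 ≤ s) (hsp : s < p) :
    ∃ f : ℝ → ℝ, MemLp f p volume ∧ ∀ t : ℝ, 0 < t → ¬ MemLp (heatConv f t) s volume := by
  have hp : 1 ≤ p := hs.trans hsp.le
  have hp0 : p ≠ 0 := (zero_lt_one.trans_le hp).ne'
  have hs0 : s ≠ 0 := (zero_lt_one.trans_le hs).ne'
  have hst : s ≠ ∞ := hsp.ne_top
  have hsr : 0 < s.toReal := ENNReal.toReal_pos hs0 hst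
  -- The exponent -1/s is borderline: the s-th power decays like 1/|x| and is not integrable,
  -- whereas the p-th power is, since p/s > 1.
  have hcont : Continuous fun x : ℝ => (1 + |x|) ^ (-s.toReal⁻¹) :=
    (by fun_prop : Continuous fun x : ℝ => 1 + |x|).rpow_const fun x => Or.inl (by positivity)
  have hmem : MemLp (fun x : ℝ => (1 + |x|) ^ (-s.toReal⁻¹)) p volume := by
    by_cases hpt : p = ∞
    · subst hpt
      refine memLp_top_of_bound hcont.aestronglyMeasurable 1 (Eventually.of_forall fun x => ?_)
      rw [Real.norm_of_nonneg (by positivity)]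
      exact Real.rpow_le_one_of_one_le_of_nonpos (by linarith [abs_nonneg x])
        (by have : 0 < s.toReal⁻¹ := inv_pos.2 hsr
            linarith)
    · rw [← integrable_norm_rpow_iff hcont.aestronglyMeasurable hp0 hpt]
      have hlt : s.toReal < p.toReal := (ENNReal.toReal_lt_toReal hst hpt).2 hsp
      have := integrable_one_add_norm (E := ℝ) (μ := volume) (r := p.toReal / s.toReal)
        (by simpa using (one_lt_div hsr).2 hlt)
      refine this.congr (Eventually.of_forall fun x => ?_)
      simp only
      rw [Real.norm_eq_abs x, Real.norm_of_nonneg (by positivity), ← Real.rpow_mul (by positivity)]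
      congr 1
      field_simp
  refine ⟨_, hmem, fun t ht hcon => ?_⟩
  have hinteg := (integrable_norm_rpow_iff hcon.1 hs0 hst).2 hcon
  have hθ := heatKernel_pos ht 1
  refine not_integrable_inv_two_add_abs ?_
  refine (hinteg.const_mul ((2 * heatKernel t 1) ^ s.toReal)⁻¹).mono'
    (Measurable.aestronglyMeasurable (by fun_prop)) (Eventually.of_forall fun x => ?_)
  have h1 := rpow_add_two_le_heatConv (inv_pos.2 hsr).le ht
    (fun x => convolutionExists_heatKernel hp hmem ht x) x
  have h2 := Real.rpow_le_rpow (by positivity) (h1.trans (le_abs_self _)) hsr.le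
  rw [Real.mul_rpow (by positivity) (by positivity), ← Real.rpow_mul (by positivity),
    neg_mul, inv_mul_cancel₀ hsr.ne', Real.rpow_neg_one] at h2
  rw [Real.norm_of_nonneg (by positivity), ← div_eq_inv_mul, le_div_iff₀ (by positivity), mul_comm]
  exact h2

/-! ### The theorem -/

theorem heatRate_eq {p q r : ℝ≥0∞} (hp : 1 ≤ p) (hq : 1 ≤ q) (hr : 1 ≤ r)
    (h : 1 / p + 1 / q = 1 + 1 / r) :
    heatRate q = fun t => t ^ (-(p.toReal⁻¹ - r.toReal⁻¹) / 2) := by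
  funext t
  rw [heatRate, one_div, ENNReal.toReal_inv, toReal_inv_of_young hp hq hr h]

theorem theorem1 (p : ℝ≥0∞) (hp : 1 ≤ p) :
    -- (a)
    (∀ f : ℝ → ℝ, MemLp f p volume → ∀ t : ℝ, 0 < t →
      ConvolutionExists f (heatKernel t) (ContinuousLinearMap.mul ℝ ℝ) volume ∧
      ∀ s : ℝ≥0∞, p ≤ s → MemLp (heatConv f t) s volume) ∧
    -- (b)
    (∀ q r : ℝ≥0∞, 1 ≤ q → 1 ≤ r → 1 / p + 1 / q = 1 + 1 / r →
      -- the estimate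
      (∀ f : ℝ → ℝ, MemLp f p volume → ∀ t : ℝ, 0 < t →
        eLpNorm (heatConv f t) r volume ≤
          ENNReal.ofReal (heatK p q r) * eLpNorm f p volume * ENNReal.ofReal (heatRate q t)) ∧
      -- the constant cannot be replaced with a smaller one
      (∀ C : ℝ, C < heatK p q r → ∃ f : ℝ → ℝ, MemLp f p volume ∧ ∃ t : ℝ, 0 < t ∧
        ENNReal.ofReal C * eLpNorm f p volume * ENNReal.ofReal (heatRate q t) <
          eLpNorm (heatConv f t) r volume) ∧
      -- sharpness of the rate as `t → 0⁺`
      (∀ ψ : ℝ → ℝ, (∀ t : ℝ, 0 < t → 0 < ψ t) → ψ =o[𝓝[>] 0] heatRate q →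
        ∃ G : ℝ → ℝ, MemLp G p volume ∧
          ¬ IsBoundedUnder (· ≤ ·) (𝓝[>] 0)
            (fun t : ℝ => (eLpNorm (heatConv G t) r volume).toReal / ψ t)) ∧
      -- sharpness of the rate as `t → ∞`
      (∀ ψ : ℝ → ℝ, (∀ t : ℝ, 0 < t → 0 < ψ t) → ψ =o[atTop] heatRate q →
        ∃ G : ℝ → ℝ, MemLp G p volume ∧
          ¬ IsBoundedUnder (· ≤ ·) atTop
            (fun t : ℝ => (eLpNorm (heatConv G t) r volume).toReal / ψ t))) ∧
    -- (c)
    (∀ s : ℝ≥0∞, 1 ≤ s → s < p → ∃ f : ℝ → ℝ, MemLp f p volume ∧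
      ∀ t : ℝ, 0 < t → ¬ MemLp (heatConv f t) s volume) := by
  refine ⟨fun f hf t ht => ⟨convolutionExists_heatKernel hp hf ht,
    fun s hps => memLp_heatConv hp hf ht hps⟩, fun q r hq hr h => ?_,
    fun s hs hsp => exists_forall_not_memLp_heatConv hs hsp⟩
  have hpr := le_of_young hq h
  have hK := heatK_eq hp hq hr h
  have hrate := heatRate_eq hp hq hr h
  have hK0 : 0 ≤ heatK p q r := mul_nonneg (Real.sqrt_nonneg _) (by rw [heatAlpha_eq hq]; positivity)
  refine ⟨fun f hf t ht => ?_, fun C hC => ?_, fun ψ hψ0 hψ => ?_, fun ψ hψ0 hψ => ?_⟩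
  · refine (eLpNorm_heatConv_le hp hpr hf ht).trans_eq ?_
    rw [← hK, hrate, ENNReal.ofReal_mul hK0, mul_right_comm]
  -- Optimality holds at each time, and t = 1 is taken. For negative C, `ENNReal.ofReal C` is 0, in
  -- agreement with max(C, 0).
  · rw [hK] at hC
    obtain ⟨f, hf, hlt⟩ := exists_lt_eLpNorm_heatConv hp hpr hC one_pos
    exact ⟨f, hf, 1, one_pos, by rwa [hrate]⟩
  · rw [hrate] at hψ
    exact exists_not_isBoundedUnder (l := 𝓝[>] (0 : ℝ)) hp hpr self_mem_nhdsWithin hψ0 hψ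
  · rw [hrate] at hψ
    exact exists_not_isBoundedUnder hp hpr (eventually_gt_atTop 0) hψ0 hψ
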